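/- Let $\Bbbk$ be a field. A ($\Bbbk$-linear) semigroup category is a small $\Bbbk$-linear category $\mathcal S$ with a functor $\otimes$ that is $\Bbbk$-linear in each variable and an associativity isomorphism $\mathsf a$ satisfying the pentagon axiom; no unit object is required. It is symmetric if it carries a natural braiding that satisfies the hexagon axioms and squares to the identity. An adjunction $(F,F^{\blacklozenge},\eta^l,\eta^r,\varepsilon^l,\varepsilon^r)$ in $\mathcal S$ consists of objects $F,F^{\blacklozenge}$, transformations of left $\mathcal S$-module functors $\eta^l:\mathrm{Id}\to -\otimes(F^{\blacklozenge}\otimes F)$, $\varepsilon^l:-\otimes(F\otimes F^{\blacklozenge})\to\mathrm{Id}$ and transformations of right $\mathcal S$-module functors $\eta^r:\mathrm{Id}\to (F^{\blacklozenge}\otimes F)\otimes -$, $\varepsilon^r:(F\otimes F^{\blacklozenge})\otimes -\to\mathrm{Id}$ such that, up to associators: (I) $(-\otimes F^{\blacklozenge},-\otimes F,\eta^l,\varepsilon^l)$ is an adjunction of left $\mathcal S$-module functors; (II) $(F\otimes -,F^{\blacklozenge}\otimes -,\eta^r,\varepsilon^r)$ is an adjunction of right $\mathcal S$-module functors; (III)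 $\varepsilon^r_F\circ\eta^l_F=\mathrm{id}_F$ and $\varepsilon^l_{F^{\blacklozenge}}\circ\eta^r_{F^{\blacklozenge}}=\mathrm{id}_{F^{\blacklozenge}}$; (IV) $\eta^l_H\otimes K=H\otimes\eta^r_K$ and $\varepsilon^l_H\otimes K=H\otimes\varepsilon^r_K$ for all $H,K$. Then $F^{\blacklozenge}$ is called a right dual of $F$, and $F$ a left dual of $F^{\blacklozenge}$. $\mathcal S$ is rigid if every object has a right dual and a left dual. **Theorem.** Let $\mathcal S$ be a rigid symmetric semigroup category. Then the category $[\mathcal S^{\mathrm{op}},\mathbf{Vec}_{\Bbbk}]$ of $\Bbbk$-linear presheaves, with Day convolution $$(P\circledast Q)(X)=\int^{H,K\in\mathcal S}\mathcal S(X,H\otimes K)\otimes_{\Bbbk}P(H)\otimes_{\Bbbk}Q(K)$$ and with the associator and symmetry that Day convolution inherits from those of $\mathcal S$, is a $\Bbbk$-linear symmetric monoidal category. Moreover, for every choice of right duals $F\mapsto(F^{\blacklozenge},\eta,\varepsilon)$, put $[F,G]=F^{\blacklozenge}\otimes G$ and let $\mathsf k_{F,G,H}:[G,H]\otimes[F,G]\to[F,H]$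 be the symmetry $[G,H]\otimes[F,G]\cong[F,G]\otimes[G,H]=F^{\blacklozenge}\otimes G\otimes G^{\blacklozenge}\otimes H$ followed by the contraction of $G\otimes G^{\blacklozenge}$, i.e. by $F^{\blacklozenge}\otimes\varepsilon^{G,r}_H$. Then the unit object of $[\mathcal S^{\mathrm{op}},\mathbf{Vec}_{\Bbbk}]$ is isomorphic to the $\mathcal S$-enriched coend of $\mathrm{Hom}(-,[F,F])$, that is, to the $\mathcal S$-enriched trace $$\mathrm{Tr}_{\mathcal S}([\![\mathcal S]\!])=\mathrm{Coeq}\Big(\coprod_{F,G\in\mathcal S}\mathrm{Hom}(-,[F,G]\otimes[G,F])\rightrightarrows\coprod_{H\in\mathcal S}\mathrm{Hom}(-,[H,H])\Big),$$ where the two maps are induced on the $(F,G)$ summand by $\mathsf k_{G,F,G}:[F,G]\otimes[G,F]\to[G,G]$ and by the symmetry followed by $\mathsf k_{F,G,F}:[G,F]\otimes[F,G]\to[F,F]$. The coproducts and the coequalizer are formed in $[\mathcal S^{\mathrm{op}},\mathbf{Vec}_{\Bbbk}]$. -/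

import Mathlib

open CategoryTheory Opposite TensorProduct

universe v u w

/-! ### Semigroup categories: monoidal categories without a unit object -/

/-- A semigroup category: a category with a tensor product bifunctor (given by its action on
objects and by whiskering of morphisms on both sides) and an associator which satisfies the
pentagon axiom. No unit object is required. -/
class SemigroupCategory (S : Type u) [Category.{v} S] where
  tensorObj : S → S → S
  whiskerLeft (X : S) {Y Z : S} (f : Y ⟶ Z) : tensorObj X Y ⟶ tensorObj X Z
  whiskerRight {X Y : S} (f : X ⟶ Y) (Z : S) : tensorObj X Z ⟶ tensorObj Y Z
  associator (X Y Z : S) : tensorObj (tensorObj X Y) Z ≅ tensorObj X (tensorObj Y Z)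
  whiskerLeft_id (X Y : S) : whiskerLeft X (𝟙 Y) = 𝟙 (tensorObj X Y)
  whiskerLeft_comp (W : S) {X Y Z : S} (f : X ⟶ Y) (g : Y ⟶ Z) :
    whiskerLeft W (f ≫ g) = whiskerLeft W f ≫ whiskerLeft W g
  id_whiskerRight (X Y : S) : whiskerRight (𝟙 X) Y = 𝟙 (tensorObj X Y)
  comp_whiskerRight {X Y Z : S} (f : X ⟶ Y) (g : Y ⟶ Z) (W : S) :
    whiskerRight (f ≫ g) W = whiskerRight f W ≫ whiskerRight g W
  whisker_exchange {W X Y Z : S} (f : W ⟶ X) (g : Y ⟶ Z) :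
    whiskerLeft W g ≫ whiskerRight f Z = whiskerRight f Y ≫ whiskerLeft X g
  associator_naturality_left {X X' : S} (f : X ⟶ X') (Y Z : S) :
    whiskerRight (whiskerRight f Y) Z ≫ (associator X' Y Z).hom =
      (associator X Y Z).hom ≫ whiskerRight f (tensorObj Y Z)
  associator_naturality_middle (X : S) {Y Y' : S} (f : Y ⟶ Y') (Z : S) :
    whiskerRight (whiskerLeft X f) Z ≫ (associator X Y' Z).hom =
      (associator X Y Z).hom ≫ whiskerLeft X (whiskerRight f Z)
  associator_naturality_right (X Y : S) {Z Z' : S} (f : Z ⟶ Z') :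
    whiskerLeft (tensorObj X Y) f ≫ (associator X Y Z').hom =
      (associator X Y Z).hom ≫ whiskerLeft X (whiskerLeft Y f)
  pentagon (W X Y Z : S) :
    whiskerRight (associator W X Y).hom Z ≫ (associator W (tensorObj X Y) Z).hom ≫
        whiskerLeft W (associator X Y Z).hom =
      (associator (tensorObj W X) Y Z).hom ≫ (associator W X (tensorObj Y Z)).hom

namespace SemigroupCategory

infixr:70 " ⊠ₛ " => SemigroupCategory.tensorObj
infixr:81 " ◁ₛ " => SemigroupCategory.whiskerLeft
infixl:81 " ▷ₛ " => SemigroupCategory.whiskerRight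
notation "αₛ" => SemigroupCategory.associator

/-- The tensor product of a `k`-linear semigroup category is `k`-linear in each variable. -/
class IsLinear (k : Type w) [Field k] (S : Type u) [Category.{v} S] [Preadditive S] [Linear k S]
    [SemigroupCategory S] : Prop where
  whiskerLeft_add (X : S) {Y Z : S} (f g : Y ⟶ Z) : X ◁ₛ (f + g) = X ◁ₛ f + X ◁ₛ g
  add_whiskerRight {Y Z : S} (f g : Y ⟶ Z) (X : S) : (f + g) ▷ₛ X = f ▷ₛ X + g ▷ₛ X
  whiskerLeft_smul (X : S) {Y Z : S} (r : k) (f : Y ⟶ Z) : X ◁ₛ (r • f) = r • (X ◁ₛ f)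
  smul_whiskerRight (r : k) {Y Z : S} (f : Y ⟶ Z) (X : S) : (r • f) ▷ₛ X = r • (f ▷ₛ X)

/-- A symmetric semigroup category: a natural braiding which satisfies the hexagon axioms and
squares to the identity. -/
class Symmetric (S : Type u) [Category.{v} S] [SemigroupCategory S] where
  braiding (X Y : S) : X ⊠ₛ Y ≅ Y ⊠ₛ X
  braiding_naturality_right (X : S) {Y Z : S} (f : Y ⟶ Z) :
    X ◁ₛ f ≫ (braiding X Z).hom = (braiding X Y).hom ≫ f ▷ₛ X
  braiding_naturality_left {X Y : S} (f : X ⟶ Y) (Z : S) :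
    f ▷ₛ Z ≫ (braiding Y Z).hom = (braiding X Z).hom ≫ Z ◁ₛ f
  hexagon_forward (X Y Z : S) :
    (αₛ X Y Z).hom ≫ (braiding X (Y ⊠ₛ Z)).hom ≫ (αₛ Y Z X).hom =
      (braiding X Y).hom ▷ₛ Z ≫ (αₛ Y X Z).hom ≫ Y ◁ₛ (braiding X Z).hom
  hexagon_reverse (X Y Z : S) :
    (αₛ X Y Z).inv ≫ (braiding (X ⊠ₛ Y) Z).hom ≫ (αₛ Z X Y).inv =
      X ◁ₛ (braiding Y Z).hom ≫ (αₛ X Z Y).inv ≫ (braiding X Z).hom ▷ₛ Y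
  symmetry (X Y : S) : (braiding X Y).hom ≫ (braiding Y X).hom = 𝟙 (X ⊠ₛ Y)

notation "βₛ" => SemigroupCategory.Symmetric.braiding

/-! ### Adjunctions and rigidity without a unit object -/

section Rigid

variable {S : Type u} [Category.{v} S] [SemigroupCategory S]

/-- A (non-unital) adjunction `(F, F', η^l, η^r, ε^l, ε^r)` in a semigroup category, exhibiting
`F'` as a right dual of `F`. -/
structure Adj (F F' : S) where
  /-- `η^l : Id ⟶ - ⊠ (F' ⊠ F)` -/
  ηl (X : S) : X ⟶ X ⊠ₛ (F' ⊠ₛ F)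
  /-- `ε^l : - ⊠ (F ⊠ F') ⟶ Id` -/
  εl (X : S) : X ⊠ₛ (F ⊠ₛ F') ⟶ X
  /-- `η^r : Id ⟶ (F' ⊠ F) ⊠ -` -/
  ηr (X : S) : X ⟶ (F' ⊠ₛ F) ⊠ₛ X
  /-- `ε^r : (F ⊠ F') ⊠ - ⟶ Id` -/
  εr (X : S) : (F ⊠ₛ F') ⊠ₛ X ⟶ X
  -- the four families are natural transformations
  ηl_naturality {X Y : S} (f : X ⟶ Y) : f ≫ ηl Y = ηl X ≫ f ▷ₛ (F' ⊠ₛ F)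
  εl_naturality {X Y : S} (f : X ⟶ Y) : f ▷ₛ (F ⊠ₛ F') ≫ εl Y = εl X ≫ f
  ηr_naturality {X Y : S} (f : X ⟶ Y) : f ≫ ηr Y = ηr X ≫ (F' ⊠ₛ F) ◁ₛ f
  εr_naturality {X Y : S} (f : X ⟶ Y) : (F ⊠ₛ F') ◁ₛ f ≫ εr Y = εr X ≫ f
  -- `η^l`, `ε^l` are transformations of left module functors
  ηl_module (H X : S) : ηl (H ⊠ₛ X) ≫ (αₛ H X (F' ⊠ₛ F)).hom = H ◁ₛ ηl X
  εl_module (H X : S) : (αₛ H X (F ⊠ₛ F')).hom ≫ H ◁ₛ εl X = εl (H ⊠ₛ X)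
  -- `η^r`, `ε^r` are transformations of right module functors
  ηr_module (X K : S) : ηr X ▷ₛ K ≫ (αₛ (F' ⊠ₛ F) X K).hom = ηr (X ⊠ₛ K)
  εr_module (X K : S) : (αₛ (F ⊠ₛ F') X K).hom ≫ εr (X ⊠ₛ K) = εr X ▷ₛ K
  -- (I) `(- ⊠ F', - ⊠ F, η^l, ε^l)` is an adjunction
  left_triangle₁ (X : S) :
    ηl X ▷ₛ F' ≫ (αₛ X F' F).inv ▷ₛ F' ≫ (αₛ (X ⊠ₛ F') F F').hom ≫ εl (X ⊠ₛ F') =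
      𝟙 (X ⊠ₛ F')
  left_triangle₂ (X : S) :
    ηl (X ⊠ₛ F) ≫ (αₛ (X ⊠ₛ F) F' F).inv ≫ (αₛ X F F').hom ▷ₛ F ≫ εl X ▷ₛ F =
      𝟙 (X ⊠ₛ F)
  -- (II) `(F ⊠ -, F' ⊠ -, η^r, ε^r)` is an adjunction
  right_triangle₁ (X : S) :
    F ◁ₛ ηr X ≫ F ◁ₛ (αₛ F' F X).hom ≫ (αₛ F F' (F ⊠ₛ X)).inv ≫ εr (F ⊠ₛ X) =
      𝟙 (F ⊠ₛ X)
  right_triangle₂ (X : S) :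
    ηr (F' ⊠ₛ X) ≫ (αₛ F' F (F' ⊠ₛ X)).hom ≫ F' ◁ₛ (αₛ F F' X).inv ≫ F' ◁ₛ εr X =
      𝟙 (F' ⊠ₛ X)
  -- (III) the two mixed zig-zag identities
  zigzag₁ : ηl F ≫ (αₛ F F' F).inv ≫ εr F = 𝟙 F
  zigzag₂ : ηr F' ≫ (αₛ F' F F').hom ≫ εl F' = 𝟙 F'
  -- (IV) compatibility of the left and the right transformations
  compat_η (H K : S) : ηl H ▷ₛ K ≫ (αₛ H (F' ⊠ₛ F) K).hom = H ◁ₛ ηr K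
  compat_ε (H K : S) : (αₛ H (F ⊠ₛ F') K).hom ≫ H ◁ₛ εr K = εl H ▷ₛ K

variable (S) in
/-- A semigroup category is rigid if each object has both a right dual and a left dual. -/
def IsRigid : Prop :=
  ∀ F : S, (∃ F' : S, Nonempty (Adj F F')) ∧ (∃ F' : S, Nonempty (Adj F' F))

variable (S) in
/-- A choice, for every object `F`, of a right dual `F'` and of an adjunction `(F, F')`. -/
structure RightDuals where
  dual : S → S
  adj (F : S) : Adj F (dual F)

/-- The internal hom `[F, G] = F' ⊠ G` of a symmetric semigroup category with right duals. -/
def RightDuals.ihom (D : RightDuals S) (F G : S) : S := D.dual F ⊠ₛ G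

/-- The contraction `[F, G] ⊠ [G, H] = (F' ⊠ G) ⊠ (G' ⊠ H) ⟶ F' ⊠ H = [F, H]` of `G ⊠ G'`
by the counit of the adjunction `(G, G')`. -/
def RightDuals.contract (D : RightDuals S) (F G H : S) : D.ihom F G ⊠ₛ D.ihom G H ⟶ D.ihom F H :=
  (αₛ (D.dual F) G (D.dual G ⊠ₛ H)).hom ≫ D.dual F ◁ₛ (αₛ G (D.dual G) H).inv ≫
    D.dual F ◁ₛ (D.adj G).εr H

/-- The composition `k_{F,G,H} : [G, H] ⊠ [F, G] ⟶ [F, H]` of the `S`-enriched category `⟦S⟧`. -/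
def RightDuals.icomp [Symmetric S] (D : RightDuals S) (F G H : S) :
    D.ihom G H ⊠ₛ D.ihom F G ⟶ D.ihom F H :=
  (βₛ (D.ihom G H) (D.ihom F G)).hom ≫ D.contract F G H

end Rigid

/-! ### Linear presheaves -/

section Presheaf

variable (k : Type u) [Field k] (S : Type u) [Category.{u} S] [Preadditive S] [Linear k S]

/-- The property of a presheaf of vector spaces on a `k`-linear category of being `k`-linear. -/
def isLinearPresheaf : ObjectProperty (Sᵒᵖ ⥤ ModuleCat.{u} k) := fun P =>
  (∀ {X Y : S} (f g : X ⟶ Y), P.map (f + g).op = P.map f.op + P.map g.op) ∧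
    ∀ {X Y : S} (r : k) (f : X ⟶ Y), P.map (r • f).op = r • P.map f.op

/-- The category `[Sᵒᵖ, Vec_k]` of `k`-linear presheaves on `S`. -/
abbrev LinPresheaf := (isLinearPresheaf k S).FullSubcategory

variable {S} in
/-- The representable presheaf `Hom(-, F)`. -/
def yo (F : S) : LinPresheaf k S where
  obj := (linearYoneda k S).obj F
  property :=
    ⟨fun f g => by ext1; exact LinearMap.ext fun h => Preadditive.add_comp _ _ _ f g h,
      fun r f => by ext1; exact LinearMap.ext fun h => Linear.smul_comp _ _ _ r f h⟩

variable {S} in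
/-- The map `Hom(-, F) ⟶ Hom(-, G)` given by composition with `f : F ⟶ G`. -/
def yoMap {F G : S} (f : F ⟶ G) : yo k F ⟶ yo k G :=
  ObjectProperty.homMk ((linearYoneda k S).map f)

end Presheaf

/-! ### Day convolution -/

noncomputable section

section Day

variable {k : Type u} [Field k] {S : Type u} [Category.{u} S] [Preadditive S] [Linear k S]

/-- The value `P(X)` of a presheaf. -/
abbrev val (P : LinPresheaf k S) (X : S) : Type u := P.obj.obj (op X)

/-- The restriction map `P(Y) → P(X)` along `f : X ⟶ Y`. -/
abbrev res (P : LinPresheaf k S) {X Y : S} (f : X ⟶ Y) : val P Y →ₗ[k] val P X :=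
  (P.obj.map f.op).hom

/-- The component `P(X) → Q(X)` of a morphism of presheaves. -/
abbrev comp {P Q : LinPresheaf k S} (φ : P ⟶ Q) (X : S) : val P X →ₗ[k] val Q X :=
  (φ.hom.app (op X)).hom

variable [SemigroupCategory S]

open Classical in
/-- The direct sum `⨁_{H, K} S(X, H ⊠ K) ⊗ P(H) ⊗ Q(K)`. -/
abbrev DaySum (P Q : LinPresheaf k S) (X : S) : Type u :=
  DirectSum (S × S) fun i => (X ⟶ i.1 ⊠ₛ i.2) ⊗[k] (val P i.1 ⊗[k] val Q i.2)

open Classical in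
/-- The element `u ⊗ p ⊗ q` of the summand of index `(H, K)`. -/
def daySumMk (P Q : LinPresheaf k S) {X H K : S} (u : X ⟶ H ⊠ₛ K) (p : val P H) (q : val Q K) :
    DaySum P Q X :=
  DirectSum.lof k (S × S) (fun i => (X ⟶ i.1 ⊠ₛ i.2) ⊗[k] (val P i.1 ⊗[k] val Q i.2)) (H, K)
    (u ⊗ₜ (p ⊗ₜ q))

/-- The relations which define the `k`-linear coend over `H` and `K`. -/
def dayRel (P Q : LinPresheaf k S) (X : S) : Submodule k (DaySum P Q X) :=
  Submodule.span k {z | ∃ (H H' K K' : S) (a : H ⟶ H') (b : K ⟶ K') (u : X ⟶ H ⊠ₛ K)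
    (p : val P H') (q : val Q K'),
    z = daySumMk P Q (u ≫ a ▷ₛ K ≫ H' ◁ₛ b) p q - daySumMk P Q u (res P a p) (res Q b q)}

/-- `(P ⊛ Q)(X) = ∫^{H, K} S(X, H ⊠ K) ⊗ P(H) ⊗ Q(K)`. -/
abbrev DayVal (P Q : LinPresheaf k S) (X : S) : Type u := DaySum P Q X ⧸ dayRel P Q X

/-- The class of `u ⊗ p ⊗ q` in `(P ⊛ Q)(X)`. -/
def dayMk (P Q : LinPresheaf k S) {X H K : S} (u : X ⟶ H ⊠ₛ K) (p : val P H) (q : val Q K) :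
    DayVal P Q X :=
  (dayRel P Q X).mkQ (daySumMk P Q u p q)

theorem dayVal_hom_ext {P Q : LinPresheaf k S} {X : S} {M : Type u} [AddCommGroup M] [Module k M]
    {f g : DayVal P Q X →ₗ[k] M}
    (h : ∀ {H K : S} (u : X ⟶ H ⊠ₛ K) (p : val P H) (q : val Q K),
      f (dayMk P Q u p q) = g (dayMk P Q u p q)) : f = g := by
  classical
  apply Submodule.linearMap_qext
  apply DirectSum.linearMap_ext
  rintro ⟨H, K⟩
  apply TensorProduct.ext'
  intro u y
  induction y using TensorProduct.induction_on with
  | zero => simp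
  | tmul p q => exact h u p q
  | add y z hy hz => rw [TensorProduct.tmul_add, map_add, map_add, hy, hz]

/-- The map of direct sums induced by `f : X ⟶ Y`, `φ : P ⟶ P'` and `ψ : Q ⟶ Q'`. -/
def daySumMap {P P' Q Q' : LinPresheaf k S} {X Y : S} (f : X ⟶ Y) (φ : P ⟶ P') (ψ : Q ⟶ Q') :
    DaySum P Q Y →ₗ[k] DaySum P' Q' X :=
  DirectSum.lmap fun i => TensorProduct.map (Linear.leftComp k (i.1 ⊠ₛ i.2) f)
    (TensorProduct.map (comp φ i.1) (comp ψ i.2))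

theorem daySumMap_mk {P P' Q Q' : LinPresheaf k S} {X Y H K : S} (f : X ⟶ Y) (φ : P ⟶ P')
    (ψ : Q ⟶ Q') (u : Y ⟶ H ⊠ₛ K) (p : val P H) (q : val Q K) :
    daySumMap f φ ψ (daySumMk P Q u p q) = daySumMk P' Q' (f ≫ u) (comp φ H p) (comp ψ K q) := by
  classical
  simp [daySumMap, daySumMk, DirectSum.lmap_lof]

/-- The map `(P ⊛ Q)(Y) → (P' ⊛ Q')(X)` which sends the class of `u ⊗ p ⊗ q` to the class of
`(f ≫ u) ⊗ φ(p) ⊗ ψ(q)`. -/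
def dayValMap {P P' Q Q' : LinPresheaf k S} {X Y : S} (f : X ⟶ Y) (φ : P ⟶ P') (ψ : Q ⟶ Q') :
    DayVal P Q Y →ₗ[k] DayVal P' Q' X :=
  (dayRel P Q Y).mapQ (dayRel P' Q' X) (daySumMap f φ ψ) <| by
    rw [dayRel, Submodule.span_le]
    rintro _ ⟨H, H', K, K', a, b, u, p, q, rfl⟩
    refine Submodule.subset_span ⟨H, H', K, K', a, b, f ≫ u, comp φ H' p, comp ψ K' q, ?_⟩
    have h₁ : comp φ H (res P a p) = res P' a (comp φ H' p) :=
      ConcreteCategory.congr_hom (φ.hom.naturality a.op) p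
    have h₂ : comp ψ K (res Q b q) = res Q' b (comp ψ K' q) :=
      ConcreteCategory.congr_hom (ψ.hom.naturality b.op) q
    rw [map_sub, daySumMap_mk, daySumMap_mk, h₁, h₂, Category.assoc]

theorem dayValMap_mk {P P' Q Q' : LinPresheaf k S} {X Y H K : S} (f : X ⟶ Y) (φ : P ⟶ P')
    (ψ : Q ⟶ Q') (u : Y ⟶ H ⊠ₛ K) (p : val P H) (q : val Q K) :
    dayValMap f φ ψ (dayMk P Q u p q) = dayMk P' Q' (f ≫ u) (comp φ H p) (comp ψ K q) := by
  simp only [dayMk, dayValMap, Submodule.mkQ_apply, Submodule.mapQ_apply, daySumMap_mk]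

theorem dayMk_add_left (P Q : LinPresheaf k S) {X H K : S} (u u' : X ⟶ H ⊠ₛ K) (p : val P H)
    (q : val Q K) : dayMk P Q (u + u') p q = dayMk P Q u p q + dayMk P Q u' p q := by
  simp [dayMk, daySumMk, TensorProduct.add_tmul]

theorem dayMk_smul_left (P Q : LinPresheaf k S) {X H K : S} (r : k) (u : X ⟶ H ⊠ₛ K) (p : val P H)
    (q : val Q K) : dayMk P Q (r • u) p q = r • dayMk P Q u p q := by
  simp only [dayMk, daySumMk, ← TensorProduct.smul_tmul', map_smul]

/-- The Day convolution `P ⊛ Q` of two linear presheaves. -/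
def dayConv (P Q : LinPresheaf k S) : LinPresheaf k S where
  obj :=
    { obj X := ModuleCat.of k (DayVal P Q X.unop)
      map f := ModuleCat.ofHom (dayValMap f.unop (𝟙 P) (𝟙 Q))
      map_id X := by
        ext1
        refine dayVal_hom_ext fun u p q => ?_
        exact (dayValMap_mk _ _ _ _ _ _).trans (by simp; rfl)
      map_comp f g := by
        ext1
        refine dayVal_hom_ext fun u p q => ?_
        refine (dayValMap_mk _ _ _ _ _ _).trans ?_
        refine Eq.trans ?_ (congrArg (dayValMap g.unop (𝟙 P) (𝟙 Q))
          (dayValMap_mk f.unop (𝟙 P) (𝟙 Q) u p q)).symm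
        refine Eq.trans ?_ (dayValMap_mk _ _ _ _ _ _).symm
        simp
        rfl }
  property := by
    refine ⟨fun f g => ?_, fun r f => ?_⟩
    · ext1
      refine dayVal_hom_ext fun u p q => ?_
      refine (dayValMap_mk _ _ _ _ _ _).trans ?_
      refine Eq.trans ?_ (congrArg₂ (· + ·) (dayValMap_mk f (𝟙 P) (𝟙 Q) u p q)
        (dayValMap_mk g (𝟙 P) (𝟙 Q) u p q)).symm
      rw [← dayMk_add_left, ← Preadditive.add_comp]
      rfl
    · ext1
      refine dayVal_hom_ext fun u p q => ?_
      refine (dayValMap_mk _ _ _ _ _ _).trans ?_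
      refine Eq.trans ?_ (congrArg (r • ·) (dayValMap_mk f (𝟙 P) (𝟙 Q) u p q)).symm
      rw [← dayMk_smul_left, ← Linear.smul_comp]
      rfl

/-- The element of the presheaf `P ⊛ Q` which is the class of `u ⊗ p ⊗ q`. -/
def dayElt (P Q : LinPresheaf k S) {X H K : S} (u : X ⟶ H ⊠ₛ K) (p : val P H) (q : val Q K) :
    val (dayConv P Q) X :=
  dayMk P Q u p q

/-- The functoriality `φ ⊛ ψ : P ⊛ Q ⟶ P' ⊛ Q'` of Day convolution. -/
def dayMap {P P' Q Q' : LinPresheaf k S} (φ : P ⟶ P') (ψ : Q ⟶ Q') :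
    dayConv P Q ⟶ dayConv P' Q' :=
  ObjectProperty.homMk
    { app X := ModuleCat.ofHom (dayValMap (𝟙 X.unop) φ ψ)
      naturality X Y f := by
        ext1
        refine dayVal_hom_ext fun u p q => ?_
        refine (congrArg (dayValMap (𝟙 Y.unop) φ ψ)
          (dayValMap_mk f.unop (𝟙 P) (𝟙 Q) u p q)).trans ?_
        refine (dayValMap_mk _ _ _ _ _ _).trans ?_
        refine Eq.trans ?_ (congrArg (dayValMap f.unop (𝟙 P') (𝟙 Q'))
          (dayValMap_mk (𝟙 X.unop) φ ψ u p q)).symm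
        refine Eq.trans ?_ (dayValMap_mk _ _ _ _ _ _).symm
        simp
        rfl }

end Day

end

/-! ### The Day convolution symmetric monoidal structure -/

section DayMonoidal

open MonoidalCategory

variable (k : Type u) [Field k] (S : Type u) [Category.{u} S] [Preadditive S] [Linear k S]
  [SemigroupCategory S] [Symmetric S]

/-- An identification of the tensor product of a symmetric monoidal structure on `[Sᵒᵖ, Vec_k]`
with Day convolution: natural isomorphisms `P ⊗ Q ≅ P ⊛ Q` under which the associator and the
braiding are those which Day convolution inherits from `S`. The latter are given on (classes of)
pure tensors, which generate, by
`u ⊗ (v ⊗ p ⊗ q) ⊗ r ↦ (u ≫ v ▷ K ≫ α) ⊗ p ⊗ (𝟙 ⊗ q ⊗ r)` and `u ⊗ p ⊗ q ↦ (u ≫ β) ⊗ q ⊗ p`. -/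
structure DayStructure [MonoidalCategory (LinPresheaf k S)] [BraidedCategory (LinPresheaf k S)] where
  iso (P Q : LinPresheaf k S) : P ⊗ Q ≅ dayConv P Q
  iso_naturality {P P' Q Q' : LinPresheaf k S} (φ : P ⟶ P') (ψ : Q ⟶ Q') :
    (φ ⊗ₘ ψ) ≫ (iso P' Q').hom = (iso P Q).hom ≫ dayMap φ ψ
  associator_hom (P Q R : LinPresheaf k S) {X H K A B : S} (u : X ⟶ H ⊠ₛ K) (v : H ⟶ A ⊠ₛ B)
    (p : val P A) (q : val Q B) (r : val R K) :
    comp (α_ P Q R).hom X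
        (comp (iso (P ⊗ Q) R).inv X
          (dayElt (P ⊗ Q) R u (comp (iso P Q).inv H (dayElt P Q v p q)) r)) =
      comp (iso P (Q ⊗ R)).inv X
        (dayElt P (Q ⊗ R) (u ≫ v ▷ₛ K ≫ (αₛ A B K).hom) p
          (comp (iso Q R).inv (B ⊠ₛ K) (dayElt Q R (𝟙 (B ⊠ₛ K)) q r)))
  braiding_hom (P Q : LinPresheaf k S) {X H K : S} (u : X ⟶ H ⊠ₛ K) (p : val P H) (q : val Q K) :
    comp (BraidedCategory.braiding P Q).hom X (comp (iso P Q).inv X (dayElt P Q u p q)) =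
      comp (iso Q P).inv X (dayElt Q P (u ≫ (βₛ H K).hom) q p)

end DayMonoidal

/-! ### The enriched trace -/

section Trace

open Limits

variable (k : Type u) [Field k] {S : Type u} [Category.{u} S] [Preadditive S] [Linear k S]
  [SemigroupCategory S] [Symmetric S]

/-- The diagram in `[Sᵒᵖ, Vec_k]` which consists of all pairs of maps
`Hom(-, [F, G] ⊠ [G, F]) ⟶ Hom(-, [G, G])`, induced by the composition of `⟦S⟧`, and
`Hom(-, [F, G] ⊠ [G, F]) ⟶ Hom(-, [F, F])`, induced by the symmetry followed by the composition.
A colimit of it is a coequalizer of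
`∐_{F, G} Hom(-, [F, G] ⊠ [G, F]) ⇉ ∐_H Hom(-, [H, H])`. -/
def traceDiagram (D : RightDuals S) :
    MultispanIndex ⟨S × S, S, fun i => i.2, fun i => i.1⟩ (LinPresheaf k S) where
  left i := yo k (D.ihom i.1 i.2 ⊠ₛ D.ihom i.2 i.1)
  right H := yo k (D.ihom H H)
  fst i := yoMap k (D.icomp i.2 i.1 i.2)
  snd i := yoMap k ((βₛ (D.ihom i.1 i.2) (D.ihom i.2 i.1)).hom ≫ D.icomp i.1 i.2 i.1)

/-- `T` is an `S`-enriched trace `Tr_S(⟦S⟧)`, that is an `S`-enriched coend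
`∫^F Hom(-, [F, F])`, in `[Sᵒᵖ, Vec_k]`: it is isomorphic to the coequalizer of
`∐_{F, G} Hom(-, [F, G] ⊠ [G, F]) ⇉ ∐_H Hom(-, [H, H])`. -/
def IsEnrichedTrace (D : RightDuals S) (T : LinPresheaf k S) : Prop :=
  ∃ c : Multicofork (traceDiagram k D), Nonempty (IsColimit c) ∧ Nonempty (T ≅ c.pt)

end Trace

end SemigroupCategory

/-! The unit is the presheaf `dayUnit`, which sends `X` to the space of transformations `θ : X ⊠ₛ -
⟶ Id` of right module functors. If `S` had a unit object `1`, this would be `Hom(-, 1)`, but the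
description needs no such object. An element `θ` acts on any presheaf by `θ ⊗ p ↦ res (θ_K) p`, and
this is the left unitor.

Duals make the unitor invertible. The counit `ε^r` of `(X, X')` is an element of the unit presheaf
in degree `X ⊠ₛ X'`, and the first mixed zig-zag identity of (III) says that `X ⟶ (X ⊠ₛ X') ⊠ₛ X ⟶
X` is the identity; so `p ↦ coact ⊗ ε ⊗ p` is a section of the unitor. It is a two-sided inverse
because elements of the unit presheaf commute with each other (`res_braiding_act`). This rests on
`assoc_whiskerLeft_act`, a consequence of the hexagon axiom that also yields the triangle axiom. The
other coherence laws descend from `S`, because maps out of a Day convolution are determined by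
universal tensors (`day_hom_ext`).

For the trace, the counits generate the unit presheaf (`LocalUnits.res_lift`), and all relations
between them follow from commutation of pairs (`LocalUnits.Compatible.res_eq`). By Yoneda and the
symmetry `F' ⊠ₛ F ≅ F ⊠ₛ F'`, the legs of a cofork on the trace diagram are a family of elements in
the degrees `F ⊠ₛ F'`. Up to a cyclic permutation of four factors, the cofork condition is precisely
this commutation (`RightDuals.compatible_iff`). Hence the unit presheaf has the universal property
of the coequalizer. -/

namespace SemigroupCategory

attribute [simp] Symmetric.symmetry whiskerLeft_id id_whiskerRight

@[simp]
theorem symmetry_assoc {S : Type u} [Category.{v} S] [SemigroupCategory S] [Symmetric S] (X Y : S)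
    {Z : S} (h : X ⊠ₛ Y ⟶ Z) : (βₛ X Y).hom ≫ (βₛ Y X).hom ≫ h = h := by
  rw [← Category.assoc, Symmetric.symmetry, Category.id_comp]

noncomputable section

/-! ### Elements of linear presheaves -/

section Presheaves

variable {k : Type u} [Field k] {S : Type u} [Category.{u} S] [Preadditive S] [Linear k S]

theorem res_id (P : LinPresheaf k S) {X : S} (p : val P X) : res P (𝟙 X) p = p := by
  simp [res]

theorem res_comp (P : LinPresheaf k S) {X Y Z : S} (f : X ⟶ Y) (g : Y ⟶ Z) (p : val P Z) :
    res P (f ≫ g) p = res P f (res P g p) := by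
  simp [res]

theorem res_add (P : LinPresheaf k S) {X Y : S} (f g : X ⟶ Y) (p : val P Y) :
    res P (f + g) p = res P f p + res P g p := by
  simp only [res, P.property.1 f g]
  rfl

theorem res_smul (P : LinPresheaf k S) {X Y : S} (r : k) (f : X ⟶ Y) (p : val P Y) :
    res P (r • f) p = r • res P f p := by
  simp only [res, P.property.2 r f]
  rfl

theorem comp_res {P Q : LinPresheaf k S} (φ : P ⟶ Q) {X Y : S} (f : X ⟶ Y) (p : val P Y) :
    comp φ X (res P f p) = res Q f (comp φ Y p) :=
  ConcreteCategory.congr_hom (φ.hom.naturality f.op) p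

theorem comp_comp {P Q R : LinPresheaf k S} (φ : P ⟶ Q) (ψ : Q ⟶ R) (X : S) (p : val P X) :
    comp (φ ≫ ψ) X p = comp ψ X (comp φ X p) :=
  rfl

theorem comp_id (P : LinPresheaf k S) (X : S) (p : val P X) : comp (𝟙 P) X p = p :=
  rfl

theorem presheaf_hom_ext {P Q : LinPresheaf k S} {φ ψ : P ⟶ Q}
    (h : ∀ (X : S) (p : val P X), comp φ X p = comp ψ X p) : φ = ψ := by
  apply ObjectProperty.hom_ext
  ext X p
  exact h X.unop p

/-- A morphism of presheaves from a natural family of linear maps. -/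
def mkHom {P Q : LinPresheaf k S} (f : ∀ X : S, val P X →ₗ[k] val Q X)
    (hf : ∀ {X Y : S} (g : X ⟶ Y) (p : val P Y), f X (res P g p) = res Q g (f Y p)) : P ⟶ Q :=
  ObjectProperty.homMk
    { app X := ModuleCat.ofHom (f X.unop)
      naturality X Y g := by
        ext p
        exact hf g.unop p }

end Presheaves

/-! ### Generators, relations and the universal property of Day convolution -/

section DayApi

variable {k : Type u} [Field k] {S : Type u} [Category.{u} S] [Preadditive S] [Linear k S]
  [SemigroupCategory S]

theorem dayElt_add₂ (P Q : LinPresheaf k S) {X H K : S} (u : X ⟶ H ⊠ₛ K) (p p' : val P H)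
    (q : val Q K) : dayElt P Q u (p + p') q = dayElt P Q u p q + dayElt P Q u p' q := by
  refine Eq.trans ?_ (map_add (dayRel P Q X).mkQ _ _)
  simp [dayElt, dayMk, daySumMk, TensorProduct.add_tmul, TensorProduct.tmul_add]
  rfl

theorem dayElt_add₃ (P Q : LinPresheaf k S) {X H K : S} (u : X ⟶ H ⊠ₛ K) (p : val P H)
    (q q' : val Q K) : dayElt P Q u p (q + q') = dayElt P Q u p q + dayElt P Q u p q' := by
  refine Eq.trans ?_ (map_add (dayRel P Q X).mkQ _ _)
  simp [dayElt, dayMk, daySumMk, TensorProduct.tmul_add]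
  rfl

theorem dayElt_smul₂ (P Q : LinPresheaf k S) {X H K : S} (r : k) (u : X ⟶ H ⊠ₛ K) (p : val P H)
    (q : val Q K) : dayElt P Q u (r • p) q = r • dayElt P Q u p q := by
  refine Eq.trans ?_ (map_smul (dayRel P Q X).mkQ r _)
  simp only [dayElt, dayMk, daySumMk, ← TensorProduct.smul_tmul', TensorProduct.tmul_smul, map_smul]
  rfl

theorem dayElt_smul₃ (P Q : LinPresheaf k S) {X H K : S} (r : k) (u : X ⟶ H ⊠ₛ K) (p : val P H)
    (q : val Q K) : dayElt P Q u p (r • q) = r • dayElt P Q u p q := by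
  refine Eq.trans ?_ (map_smul (dayRel P Q X).mkQ r _)
  simp only [dayElt, dayMk, daySumMk, TensorProduct.tmul_smul, map_smul]
  rfl

theorem dayElt_rel (P Q : LinPresheaf k S) {X H H' K K' : S} (a : H ⟶ H') (b : K ⟶ K')
    (u : X ⟶ H ⊠ₛ K) (p : val P H') (q : val Q K') :
    dayElt P Q (u ≫ a ▷ₛ K ≫ H' ◁ₛ b) p q = dayElt P Q u (res P a p) (res Q b q) :=
  (Submodule.Quotient.eq _).2 (Submodule.subset_span ⟨H, H', K, K', a, b, u, p, q, rfl⟩)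

theorem dayElt_res_left (P Q : LinPresheaf k S) {X H H' K : S} (a : H ⟶ H')
    (u : X ⟶ H ⊠ₛ K) (p : val P H') (q : val Q K) :
    dayElt P Q u (res P a p) q = dayElt P Q (u ≫ a ▷ₛ K) p q := by
  simpa [res_id] using (dayElt_rel P Q a (𝟙 K) u p q).symm

theorem dayElt_res_right (P Q : LinPresheaf k S) {X H K K' : S} (b : K ⟶ K')
    (u : X ⟶ H ⊠ₛ K) (p : val P H) (q : val Q K') :
    dayElt P Q u p (res Q b q) = dayElt P Q (u ≫ H ◁ₛ b) p q := by
  simpa [res_id] using (dayElt_rel P Q (𝟙 H) b u p q).symm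

theorem res_dayElt (P Q : LinPresheaf k S) {X Y H K : S} (f : X ⟶ Y) (u : Y ⟶ H ⊠ₛ K)
    (p : val P H) (q : val Q K) :
    res (dayConv P Q) f (dayElt P Q u p q) = dayElt P Q (f ≫ u) p q :=
  dayValMap_mk f (𝟙 P) (𝟙 Q) u p q

/-- The tensors with identity first entry are universal: naturality carries any identity checked on
them to all generators. -/
theorem dayElt_eq_res (P Q : LinPresheaf k S) {X H K : S} (u : X ⟶ H ⊠ₛ K)
    (p : val P H) (q : val Q K) :
    dayElt P Q u p q = res (dayConv P Q) u (dayElt P Q (𝟙 _) p q) := by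
  rw [res_dayElt, Category.comp_id]

theorem comp_dayMap {P P' Q Q' : LinPresheaf k S} (φ : P ⟶ P') (ψ : Q ⟶ Q') {X H K : S}
    (u : X ⟶ H ⊠ₛ K) (p : val P H) (q : val Q K) :
    comp (dayMap φ ψ) X (dayElt P Q u p q) = dayElt P' Q' u (comp φ H p) (comp ψ K q) :=
  (dayValMap_mk (𝟙 X) φ ψ u p q).trans (by rw [Category.id_comp]; rfl)

theorem day_induction {P Q : LinPresheaf k S} {X : S} {motive : val (dayConv P Q) X → Prop}
    (elt : ∀ {H K : S} (u : X ⟶ H ⊠ₛ K) (p : val P H) (q : val Q K), motive (dayElt P Q u p q))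
    (add : ∀ y z, motive y → motive z → motive (y + z)) (z : val (dayConv P Q) X) : motive z := by
  classical
  -- Zero is itself a pure tensor, so the induction principle needs no separate case for it.
  have zero : motive 0 := by
    have h := elt (0 : X ⟶ X ⊠ₛ X) (0 : val P X) (0 : val Q X)
    rwa [← zero_smul k (0 : val Q X), dayElt_smul₃, zero_smul] at h
  obtain ⟨z, rfl⟩ := (dayRel P Q X).mkQ_surjective z
  induction z using DirectSum.induction_on with
  | zero => rw [map_zero]; exact zero
  | of i x =>
    obtain ⟨H, K⟩ := i
    induction x using TensorProduct.induction_on with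
    | zero => rw [map_zero, map_zero]; exact zero
    | add y z hy hz => rw [map_add, map_add]; exact add _ _ hy hz
    | tmul u x =>
      induction x using TensorProduct.induction_on with
      | zero => rw [TensorProduct.tmul_zero, map_zero, map_zero]; exact zero
      | add y z hy hz => rw [TensorProduct.tmul_add, map_add, map_add]; exact add _ _ hy hz
      | tmul p q => exact elt u p q
  | add y z hy hz => rw [map_add]; exact add _ _ hy hz

theorem day_hom_ext {P Q R : LinPresheaf k S} {φ ψ : dayConv P Q ⟶ R}
    (h : ∀ {H K : S} (p : val P H) (q : val Q K),
      comp φ (H ⊠ₛ K) (dayElt P Q (𝟙 _) p q) = comp ψ (H ⊠ₛ K) (dayElt P Q (𝟙 _) p q)) :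
    φ = ψ := by
  refine presheaf_hom_ext fun X z => ?_
  induction z using day_induction with
  | elt u p q => rw [dayElt_eq_res, comp_res, comp_res, h]
  | add y z hy hz => rw [map_add, map_add, hy, hz]

/-- The first entry of the inner tensor is moved across the coend relation into the outer one, where
naturality removes it. The variants below work in the same way. -/
theorem day_hom_ext_left {P Q R T : LinPresheaf k S} {φ ψ : dayConv (dayConv P Q) R ⟶ T}
    (h : ∀ {A B K : S} (p : val P A) (q : val Q B) (r : val R K),
      comp φ _ (dayElt (dayConv P Q) R (𝟙 _) (dayElt P Q (𝟙 (A ⊠ₛ B)) p q) r) =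
        comp ψ _ (dayElt (dayConv P Q) R (𝟙 _) (dayElt P Q (𝟙 (A ⊠ₛ B)) p q) r)) :
    φ = ψ := by
  refine day_hom_ext fun {H K} z r => ?_
  induction z using day_induction with
  | elt u p q => rw [dayElt_eq_res P Q, dayElt_res_left, dayElt_eq_res, comp_res, comp_res, h]
  | add y z hy hz => rw [dayElt_add₂, map_add, map_add, hy, hz]

theorem day_hom_ext_right {P Q R T : LinPresheaf k S} {φ ψ : dayConv P (dayConv Q R) ⟶ T}
    (h : ∀ {H A B : S} (p : val P H) (q : val Q A) (r : val R B),
      comp φ _ (dayElt P (dayConv Q R) (𝟙 _) p (dayElt Q R (𝟙 (A ⊠ₛ B)) q r)) =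
        comp ψ _ (dayElt P (dayConv Q R) (𝟙 _) p (dayElt Q R (𝟙 (A ⊠ₛ B)) q r))) :
    φ = ψ := by
  refine day_hom_ext fun {H K} p z => ?_
  induction z using day_induction with
  | elt u q r => rw [dayElt_eq_res Q R, dayElt_res_right, dayElt_eq_res, comp_res, comp_res, h]
  | add y z hy hz => rw [dayElt_add₃, map_add, map_add, hy, hz]

theorem day_hom_ext_left_left {P Q R M T : LinPresheaf k S}
    {φ ψ : dayConv (dayConv (dayConv P Q) R) M ⟶ T}
    (h : ∀ {A B K L : S} (p : val P A) (q : val Q B) (r : val R K) (m : val M L),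
      comp φ _ (dayElt (dayConv (dayConv P Q) R) M (𝟙 _)
        (dayElt (dayConv P Q) R (𝟙 _) (dayElt P Q (𝟙 (A ⊠ₛ B)) p q) r) m) =
      comp ψ _ (dayElt (dayConv (dayConv P Q) R) M (𝟙 _)
        (dayElt (dayConv P Q) R (𝟙 _) (dayElt P Q (𝟙 (A ⊠ₛ B)) p q) r) m)) :
    φ = ψ := by
  refine day_hom_ext_left fun {H K L} z r m => ?_
  induction z using day_induction with
  | elt u p q =>
    rw [dayElt_eq_res P Q, dayElt_res_left, dayElt_eq_res (dayConv P Q), dayElt_res_left,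
      dayElt_eq_res, comp_res, comp_res, h]
  | add y z hy hz => rw [dayElt_add₂, dayElt_add₂, map_add, map_add, hy, hz]

/-- A natural family of bilinear maps `P(H) × Q(K) → R(H ⊠ K)`. -/
structure DayFamily (P Q R : LinPresheaf k S) where
  toFun {H K : S} (p : val P H) (q : val Q K) : val R (H ⊠ₛ K)
  add_left {H K : S} (p p' : val P H) (q : val Q K) : toFun (p + p') q = toFun p q + toFun p' q
  smul_left {H K : S} (r : k) (p : val P H) (q : val Q K) : toFun (r • p) q = r • toFun p q
  add_right {H K : S} (p : val P H) (q q' : val Q K) : toFun p (q + q') = toFun p q + toFun p q'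
  smul_right {H K : S} (r : k) (p : val P H) (q : val Q K) : toFun p (r • q) = r • toFun p q
  res_left {H H' K : S} (a : H ⟶ H') (p : val P H') (q : val Q K) :
    toFun (res P a p) q = res R (a ▷ₛ K) (toFun p q)
  res_right {H K K' : S} (b : K ⟶ K') (p : val P H) (q : val Q K') :
    toFun p (res Q b q) = res R (H ◁ₛ b) (toFun p q)

namespace DayFamily

variable {P Q R : LinPresheaf k S} (F : DayFamily P Q R)

/-- The trilinear map `u, p, q ↦ res u (F p q)` in a fixed degree. -/
def trilinear (X H K : S) :
    (X ⟶ H ⊠ₛ K) →ₗ[k] val P H ⊗[k] val Q K →ₗ[k] val R X :=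
  LinearMap.mk₂ k
    (fun u y => res R u (TensorProduct.lift
      (LinearMap.mk₂ k F.toFun F.add_left F.smul_left F.add_right F.smul_right) y))
    (fun u u' y => res_add R u u' _) (fun r u y => res_smul R r u _)
    (fun u y y' => by rw [map_add, map_add]) (fun r u y => by rw [map_smul, map_smul])

open Classical in
/-- The linear map `u ⊗ p ⊗ q ↦ res u (F p q)` on the direct sum. -/
def sumDesc (X : S) : DaySum P Q X →ₗ[k] val R X :=
  DirectSum.toModule k (S × S) _ fun i => TensorProduct.lift (F.trilinear X i.1 i.2)

theorem sumDesc_mk {X H K : S} (u : X ⟶ H ⊠ₛ K) (p : val P H) (q : val Q K) :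
    F.sumDesc X (daySumMk P Q u p q) = res R u (F.toFun p q) := by
  classical
  simp only [sumDesc, daySumMk, DirectSum.toModule_lof, TensorProduct.lift.tmul]
  rfl

/-- The linear map `u ⊗ p ⊗ q ↦ res u (F p q)` on a component of the Day convolution. -/
def valDesc (X : S) : DayVal P Q X →ₗ[k] val R X :=
  (dayRel P Q X).liftQ (F.sumDesc X) <| by
    rw [dayRel, Submodule.span_le]
    rintro _ ⟨H, H', K, K', a, b, u, p, q, rfl⟩
    rw [SetLike.mem_coe, LinearMap.mem_ker, map_sub, sumDesc_mk, sumDesc_mk, res_comp, res_comp,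
      F.res_left, F.res_right, sub_self]

/-- The morphism out of the Day convolution which corresponds to a natural family of bilinear
maps. -/
def desc : dayConv P Q ⟶ R :=
  mkHom (fun X => F.valDesc X) fun {X Y} g z => by
    induction z using day_induction with
    | elt u p q =>
      rw [res_dayElt]
      refine (F.sumDesc_mk _ p q).trans ?_
      rw [res_comp]
      exact congrArg (res R g) (F.sumDesc_mk u p q).symm
    | add y z hy hz =>
      rw [map_add]
      refine (map_add (F.valDesc X) _ _).trans ((congrArg₂ (· + ·) hy hz).trans ?_)
      refine (map_add (res R g) _ _).symm.trans ?_
      exact congrArg (res R g) (map_add (F.valDesc Y) _ _).symm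

theorem comp_desc {X H K : S} (u : X ⟶ H ⊠ₛ K) (p : val P H) (q : val Q K) :
    comp F.desc X (dayElt P Q u p q) = res R u (F.toFun p q) :=
  F.sumDesc_mk u p q

end DayFamily

theorem dayMap_id (P Q : LinPresheaf k S) : dayMap (𝟙 P) (𝟙 Q) = 𝟙 (dayConv P Q) :=
  day_hom_ext fun p q => by rw [comp_dayMap, comp_id, comp_id, comp_id]

theorem dayMap_comp {P P' P'' Q Q' Q'' : LinPresheaf k S} (φ : P ⟶ P') (φ' : P' ⟶ P'')
    (ψ : Q ⟶ Q') (ψ' : Q' ⟶ Q'') :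
    dayMap φ ψ ≫ dayMap φ' ψ' = dayMap (φ ≫ φ') (ψ ≫ ψ') :=
  day_hom_ext fun p q => by simp only [comp_comp, comp_dayMap]

theorem dayMap_add_right {P P' Q Q' : LinPresheaf k S} (φ : P ⟶ P') (ψ ψ' : Q ⟶ Q') :
    dayMap φ (ψ + ψ') = dayMap φ ψ + dayMap φ ψ' :=
  day_hom_ext fun p q => by
    refine (comp_dayMap φ (ψ + ψ') _ p q).trans ?_
    refine (dayElt_add₃ _ _ _ _ _ _).trans ?_
    exact congrArg₂ (· + ·) (comp_dayMap φ ψ _ p q).symm (comp_dayMap φ ψ' _ p q).symm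

theorem dayMap_add_left {P P' Q Q' : LinPresheaf k S} (φ φ' : P ⟶ P') (ψ : Q ⟶ Q') :
    dayMap (φ + φ') ψ = dayMap φ ψ + dayMap φ' ψ :=
  day_hom_ext fun p q => by
    refine (comp_dayMap (φ + φ') ψ _ p q).trans ?_
    refine (dayElt_add₂ _ _ _ _ _ _).trans ?_
    exact congrArg₂ (· + ·) (comp_dayMap φ ψ _ p q).symm (comp_dayMap φ' ψ _ p q).symm

theorem dayMap_smul_right {P P' Q Q' : LinPresheaf k S} (φ : P ⟶ P') (r : k) (ψ : Q ⟶ Q') :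
    dayMap φ (r • ψ) = r • dayMap φ ψ :=
  day_hom_ext fun p q => by
    refine (comp_dayMap φ (r • ψ) _ p q).trans ?_
    refine (dayElt_smul₃ _ _ _ _ _ _).trans ?_
    exact congrArg (r • ·) (comp_dayMap φ ψ _ p q).symm

theorem dayMap_smul_left {P P' Q Q' : LinPresheaf k S} (r : k) (φ : P ⟶ P') (ψ : Q ⟶ Q') :
    dayMap (r • φ) ψ = r • dayMap φ ψ :=
  day_hom_ext fun p q => by
    refine (comp_dayMap (r • φ) ψ _ p q).trans ?_
    refine (dayElt_smul₂ _ _ _ _ _ _).trans ?_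
    exact congrArg (r • ·) (comp_dayMap φ ψ _ p q).symm

end DayApi

/-! ### The associator, obtained by currying through shifted presheaves, and the pentagon -/

section Associator

variable {k : Type u} [Field k] {S : Type u} [Category.{u} S] [Preadditive S] [Linear k S]
  [SemigroupCategory S] [IsLinear k S]

/-- The presheaf `X ↦ T(X ⊠ K)`. -/
def shiftRight (T : LinPresheaf k S) (K : S) : LinPresheaf k S where
  obj :=
    { obj X := T.obj.obj (op (X.unop ⊠ₛ K))
      map f := T.obj.map (f.unop ▷ₛ K).op
      map_id X := by simp
      map_comp f g := by simp [comp_whiskerRight] }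
  property := by
    refine ⟨fun f g => ?_, fun r f => ?_⟩
    · exact (congrArg (fun h => T.obj.map (Quiver.Hom.op h))
        (IsLinear.add_whiskerRight k f g K)).trans (T.property.1 _ _)
    · exact (congrArg (fun h => T.obj.map (Quiver.Hom.op h))
        (IsLinear.smul_whiskerRight r f K)).trans (T.property.2 _ _)

/-- The presheaf `X ↦ T(H ⊠ X)`. -/
def shiftLeft (T : LinPresheaf k S) (H : S) : LinPresheaf k S where
  obj :=
    { obj X := T.obj.obj (op (H ⊠ₛ X.unop))
      map f := T.obj.map (H ◁ₛ f.unop).op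
      map_id X := by simp
      map_comp f g := by simp [whiskerLeft_comp] }
  property := by
    refine ⟨fun f g => ?_, fun r f => ?_⟩
    · exact (congrArg (fun h => T.obj.map (Quiver.Hom.op h))
        (IsLinear.whiskerLeft_add k H f g)).trans (T.property.1 _ _)
    · exact (congrArg (fun h => T.obj.map (Quiver.Hom.op h))
        (IsLinear.whiskerLeft_smul H r f)).trans (T.property.2 _ _)

theorem res_shiftRight (T : LinPresheaf k S) (K : S) {X Y : S} (f : X ⟶ Y) (t : val T (Y ⊠ₛ K)) :
    res (shiftRight T K) f t = res T (f ▷ₛ K) t :=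
  rfl

theorem res_shiftLeft (T : LinPresheaf k S) (H : S) {X Y : S} (f : X ⟶ Y) (t : val T (H ⊠ₛ Y)) :
    res (shiftLeft T H) f t = res T (H ◁ₛ f) t :=
  rfl

/-- For fixed `r ∈ R(K)`, the family `p, q ↦ α ⊗ p ⊗ (1 ⊗ q ⊗ r)`. -/
def assocFamilyAux (P Q : LinPresheaf k S) {R : LinPresheaf k S} {K : S} (r : val R K) :
    DayFamily P Q (shiftRight (dayConv P (dayConv Q R)) K) where
  toFun {A B} p q := dayElt P (dayConv Q R) (αₛ A B K).hom p (dayElt Q R (𝟙 _) q r)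
  add_left p p' q := dayElt_add₂ _ _ _ _ _ _
  smul_left c p q := dayElt_smul₂ _ _ _ _ _ _
  add_right p q q' := by rw [dayElt_add₂, dayElt_add₃]; rfl
  smul_right c p q := by rw [dayElt_smul₂, dayElt_smul₃]; rfl
  res_left a p q := by
    rw [res_shiftRight, dayElt_res_left, res_dayElt, associator_naturality_left]
  res_right b p q := by
    rw [res_shiftRight, dayElt_res_left, Category.id_comp, dayElt_eq_res Q R, dayElt_res_right,
      res_dayElt, associator_naturality_middle]

/-- For fixed `p ∈ P(H)`, the family `q, r ↦ α⁻¹ ⊗ (1 ⊗ p ⊗ q) ⊗ r`. -/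
def assocInvFamilyAux {P : LinPresheaf k S} (Q R : LinPresheaf k S) {H : S} (p : val P H) :
    DayFamily Q R (shiftLeft (dayConv (dayConv P Q) R) H) where
  toFun {A B} q r := dayElt (dayConv P Q) R (αₛ H A B).inv (dayElt P Q (𝟙 _) p q) r
  add_left p p' q := by rw [dayElt_add₃, dayElt_add₂]; rfl
  smul_left c p q := by rw [dayElt_smul₃, dayElt_smul₂]; rfl
  add_right p q q' := dayElt_add₃ _ _ _ _ _ _
  smul_right c p q := dayElt_smul₃ _ _ _ _ _ _
  res_left {A A' B} a q r := by
    have h : (αₛ H A B).inv ≫ (H ◁ₛ a) ▷ₛ B = H ◁ₛ (a ▷ₛ B) ≫ (αₛ H A' B).inv := by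
      rw [Iso.inv_comp_eq, ← Category.assoc, Iso.eq_comp_inv, associator_naturality_middle]
    rw [res_shiftLeft, dayElt_res_right, Category.id_comp, dayElt_eq_res P Q, dayElt_res_left,
      res_dayElt, h]
  res_right {A B B'} b q r := by
    have h : (αₛ H A B).inv ≫ (H ⊠ₛ A) ◁ₛ b = H ◁ₛ (A ◁ₛ b) ≫ (αₛ H A B').inv := by
      rw [Iso.inv_comp_eq, ← Category.assoc, Iso.eq_comp_inv, associator_naturality_right]
    rw [res_shiftLeft, dayElt_res_right, res_dayElt, h]

theorem comp_assocFamilyAux (P Q : LinPresheaf k S) {R : LinPresheaf k S} {H A B K : S}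
    (r : val R K) (v : H ⟶ A ⊠ₛ B) (p : val P A) (q : val Q B) :
    comp (assocFamilyAux P Q r).desc H (dayElt P Q v p q) =
      (dayElt P (dayConv Q R) (v ▷ₛ K ≫ (αₛ A B K).hom) p (dayElt Q R (𝟙 _) q r) :) := by
  rw [DayFamily.comp_desc]
  exact res_dayElt _ _ _ _ _ _

theorem comp_assocInvFamilyAux {P : LinPresheaf k S} (Q R : LinPresheaf k S) {H A B K : S}
    (p : val P H) (v : K ⟶ A ⊠ₛ B) (q : val Q A) (r : val R B) :
    comp (assocInvFamilyAux Q R p).desc K (dayElt Q R v q r) =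
      (dayElt (dayConv P Q) R (H ◁ₛ v ≫ (αₛ H A B).inv) (dayElt P Q (𝟙 _) p q) r :) := by
  rw [DayFamily.comp_desc]
  exact res_dayElt _ _ _ _ _ _

/-- The natural family which defines the associator of Day convolution. -/
def assocFamily (P Q R : LinPresheaf k S) :
    DayFamily (dayConv P Q) R (dayConv P (dayConv Q R)) where
  toFun {H K} z r := comp (assocFamilyAux P Q r).desc H z
  add_left z z' r := map_add _ _ _
  smul_left c z r := map_smul _ _ _
  add_right z r r' := by
    induction z using day_induction with
    | elt v p q =>
      simp only [comp_assocFamilyAux]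
      rw [dayElt_add₃ Q R, dayElt_add₃]
    | add y z hy hz =>
      rw [map_add, hy, hz, map_add, map_add]
      exact add_add_add_comm _ _ _ _
  smul_right c z r := by
    induction z using day_induction with
    | elt v p q =>
      simp only [comp_assocFamilyAux]
      rw [dayElt_smul₃ Q R, dayElt_smul₃]
    | add y z hy hz =>
      rw [map_add, hy, hz, map_add]
      exact (smul_add _ _ _).symm
  res_left a z r := comp_res _ _ _
  res_right b z r := by
    induction z using day_induction with
    | elt v p q =>
      simp only [comp_assocFamilyAux]
      rw [res_dayElt, dayElt_res_right, Category.id_comp, dayElt_eq_res Q R, dayElt_res_right,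
        ← Category.assoc (_ ◁ₛ b), whisker_exchange, Category.assoc, Category.assoc,
        associator_naturality_right]
    | add y z hy hz =>
      rw [map_add, hy, hz, map_add]
      exact (map_add (res _ _) _ _).symm

/-- The natural family which defines the inverse of the associator of Day convolution. -/
def assocInvFamily (P Q R : LinPresheaf k S) :
    DayFamily P (dayConv Q R) (dayConv (dayConv P Q) R) where
  toFun {H K} p z := comp (assocInvFamilyAux Q R p).desc K z
  add_right p z z' := map_add _ _ _
  smul_right c p z := map_smul _ _ _
  add_left p p' z := by
    induction z using day_induction with
    | elt v q r =>
      simp only [comp_assocInvFamilyAux]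
      rw [dayElt_add₂ P Q, dayElt_add₂]
    | add y z hy hz =>
      rw [map_add, hy, hz, map_add, map_add]
      exact add_add_add_comm _ _ _ _
  smul_left c p z := by
    induction z using day_induction with
    | elt v q r =>
      simp only [comp_assocInvFamilyAux]
      rw [dayElt_smul₂ P Q, dayElt_smul₂]
    | add y z hy hz =>
      rw [map_add, hy, hz, map_add]
      exact (smul_add _ _ _).symm
  res_right a p z := comp_res _ _ _
  res_left {H H' K} a p z := by
    induction z using day_induction with
    | @elt A B v q r =>
      have h : (αₛ H A B).inv ≫ (a ▷ₛ A) ▷ₛ B = a ▷ₛ (A ⊠ₛ B) ≫ (αₛ H' A B).inv := by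
        rw [Iso.inv_comp_eq, ← Category.assoc, Iso.eq_comp_inv, associator_naturality_left]
      simp only [comp_assocInvFamilyAux]
      rw [res_dayElt, dayElt_res_left, Category.id_comp, dayElt_eq_res P Q, dayElt_res_left,
        ← Category.assoc (a ▷ₛ _), ← whisker_exchange, Category.assoc, Category.assoc, h]
    | add y z hy hz =>
      rw [map_add, hy, hz, map_add]
      exact (map_add (res _ _) _ _).symm

theorem comp_assoc (P Q R : LinPresheaf k S) {X H A B K : S} (u : X ⟶ H ⊠ₛ K) (v : H ⟶ A ⊠ₛ B)
    (p : val P A) (q : val Q B) (r : val R K) :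
    comp (assocFamily P Q R).desc X (dayElt (dayConv P Q) R u (dayElt P Q v p q) r) =
      dayElt P (dayConv Q R) (u ≫ v ▷ₛ K ≫ (αₛ A B K).hom) p (dayElt Q R (𝟙 _) q r) := by
  rw [DayFamily.comp_desc]
  exact (congrArg (res _ u) (comp_assocFamilyAux P Q r v p q)).trans (res_dayElt _ _ _ _ _ _)

theorem comp_assocInv (P Q R : LinPresheaf k S) {X H A B K : S} (u : X ⟶ H ⊠ₛ K) (v : K ⟶ A ⊠ₛ B)
    (p : val P H) (q : val Q A) (r : val R B) :
    comp (assocInvFamily P Q R).desc X (dayElt P (dayConv Q R) u p (dayElt Q R v q r)) =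
      dayElt (dayConv P Q) R (u ≫ H ◁ₛ v ≫ (αₛ H A B).inv) (dayElt P Q (𝟙 _) p q) r := by
  rw [DayFamily.comp_desc]
  exact (congrArg (res _ u) (comp_assocInvFamilyAux Q R p v q r)).trans (res_dayElt _ _ _ _ _ _)

/-- The associator of Day convolution. -/
def dayAssoc (P Q R : LinPresheaf k S) :
    dayConv (dayConv P Q) R ≅ dayConv P (dayConv Q R) where
  hom := (assocFamily P Q R).desc
  inv := (assocInvFamily P Q R).desc
  hom_inv_id := day_hom_ext_left fun p q r => by
    rw [comp_comp, comp_assoc, comp_assocInv, comp_id]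
    simp
  inv_hom_id := day_hom_ext_right fun p q r => by
    rw [comp_comp, comp_assocInv, comp_assoc, comp_id]
    simp

theorem comp_dayAssoc (P Q R : LinPresheaf k S) {X H A B K : S} (u : X ⟶ H ⊠ₛ K)
    (v : H ⟶ A ⊠ₛ B) (p : val P A) (q : val Q B) (r : val R K) :
    comp (dayAssoc P Q R).hom X (dayElt (dayConv P Q) R u (dayElt P Q v p q) r) =
      dayElt P (dayConv Q R) (u ≫ v ▷ₛ K ≫ (αₛ A B K).hom) p (dayElt Q R (𝟙 _) q r) :=
  comp_assoc P Q R u v p q r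

theorem comp_dayAssoc_inv (P Q R : LinPresheaf k S) {X H A B K : S} (u : X ⟶ H ⊠ₛ K)
    (v : K ⟶ A ⊠ₛ B) (p : val P H) (q : val Q A) (r : val R B) :
    comp (dayAssoc P Q R).inv X (dayElt P (dayConv Q R) u p (dayElt Q R v q r)) =
      dayElt (dayConv P Q) R (u ≫ H ◁ₛ v ≫ (αₛ H A B).inv) (dayElt P Q (𝟙 _) p q) r :=
  comp_assocInv P Q R u v p q r

theorem dayAssoc_naturality {P P' Q Q' R R' : LinPresheaf k S} (φ : P ⟶ P') (ψ : Q ⟶ Q')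
    (χ : R ⟶ R') :
    dayMap (dayMap φ ψ) χ ≫ (dayAssoc P' Q' R').hom =
      (dayAssoc P Q R).hom ≫ dayMap φ (dayMap ψ χ) :=
  day_hom_ext_left fun p q r => by
    simp only [comp_comp, comp_dayMap, comp_dayAssoc]

/-- On universal tensors both sides are the same tensor with a different first entry, and the two
entries are the two sides of the pentagon in `S`. -/
theorem dayPentagon (P Q R M : LinPresheaf k S) :
    dayMap (dayAssoc P Q R).hom (𝟙 M) ≫ (dayAssoc P (dayConv Q R) M).hom ≫
        dayMap (𝟙 P) (dayAssoc Q R M).hom =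
      (dayAssoc (dayConv P Q) R M).hom ≫ (dayAssoc P Q (dayConv R M)).hom :=
  day_hom_ext_left_left fun p q r m => by
    simp only [comp_comp, comp_dayMap, comp_dayAssoc, comp_id]
    simp only [Category.id_comp, id_whiskerRight]
    -- The inner associator sits in the second slot; the coend relation pulls it out as a left
    -- whiskering.
    rw [dayElt_eq_res Q (dayConv R M), dayElt_res_right]
    simp only [Category.assoc, pentagon]

end Associator

/-! ### The symmetry and the hexagons -/

section Braiding

variable {k : Type u} [Field k] {S : Type u} [Category.{u} S] [Preadditive S] [Linear k S]
  [SemigroupCategory S] [Symmetric S]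

/-- The natural family which defines the symmetry of Day convolution. -/
def braidFamily (P Q : LinPresheaf k S) : DayFamily P Q (dayConv Q P) where
  toFun {H K} p q := dayElt Q P (βₛ H K).hom q p
  add_left p p' q := dayElt_add₃ _ _ _ _ _ _
  smul_left c p q := dayElt_smul₃ _ _ _ _ _ _
  add_right p q q' := dayElt_add₂ _ _ _ _ _ _
  smul_right c p q := dayElt_smul₂ _ _ _ _ _ _
  res_left a p q := by
    rw [dayElt_res_right, res_dayElt, Symmetric.braiding_naturality_left]
  res_right b p q := by
    rw [dayElt_res_left, res_dayElt, Symmetric.braiding_naturality_right]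

theorem comp_braidFamily (P Q : LinPresheaf k S) {X H K : S} (u : X ⟶ H ⊠ₛ K) (p : val P H)
    (q : val Q K) :
    comp (braidFamily P Q).desc X (dayElt P Q u p q) = dayElt Q P (u ≫ (βₛ H K).hom) q p := by
  rw [DayFamily.comp_desc]
  exact res_dayElt _ _ _ _ _ _

/-- The symmetry of Day convolution. -/
def dayBraid (P Q : LinPresheaf k S) : dayConv P Q ≅ dayConv Q P where
  hom := (braidFamily P Q).desc
  inv := (braidFamily Q P).desc
  hom_inv_id := day_hom_ext fun p q => by
    rw [comp_comp, comp_braidFamily, comp_braidFamily, comp_id]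
    simp
  inv_hom_id := day_hom_ext fun p q => by
    rw [comp_comp, comp_braidFamily, comp_braidFamily, comp_id]
    simp

theorem comp_dayBraid (P Q : LinPresheaf k S) {X H K : S} (u : X ⟶ H ⊠ₛ K) (p : val P H)
    (q : val Q K) :
    comp (dayBraid P Q).hom X (dayElt P Q u p q) = dayElt Q P (u ≫ (βₛ H K).hom) q p :=
  comp_braidFamily P Q u p q

theorem dayBraid_naturality {P P' Q Q' : LinPresheaf k S} (φ : P ⟶ P') (ψ : Q ⟶ Q') :
    dayMap φ ψ ≫ (dayBraid P' Q').hom = (dayBraid P Q).hom ≫ dayMap ψ φ :=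
  day_hom_ext fun p q => by simp only [comp_comp, comp_dayMap, comp_dayBraid]

theorem dayBraid_symmetry (P Q : LinPresheaf k S) :
    (dayBraid P Q).hom ≫ (dayBraid Q P).hom = 𝟙 (dayConv P Q) :=
  (dayBraid P Q).hom_inv_id

variable [IsLinear k S]

theorem dayHexagon_forward (P Q R : LinPresheaf k S) :
    (dayAssoc P Q R).hom ≫ (dayBraid P (dayConv Q R)).hom ≫ (dayAssoc Q R P).hom =
      dayMap (dayBraid P Q).hom (𝟙 R) ≫ (dayAssoc Q P R).hom ≫
        dayMap (𝟙 Q) (dayBraid P R).hom :=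
  day_hom_ext_left fun p q r => by
    simp only [comp_comp, comp_dayMap, comp_dayAssoc, comp_dayBraid, comp_id]
    rw [dayElt_eq_res R P (_ ≫ _), dayElt_res_right]
    simp only [Category.id_comp, id_whiskerRight, Category.assoc, Symmetric.hexagon_forward]

theorem dayHexagon_reverse (P Q R : LinPresheaf k S) :
    (dayAssoc P Q R).inv ≫ (dayBraid (dayConv P Q) R).hom ≫ (dayAssoc R P Q).inv =
      dayMap (𝟙 P) (dayBraid Q R).hom ≫ (dayAssoc P R Q).inv ≫
        dayMap (dayBraid P R).hom (𝟙 Q) :=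
  day_hom_ext_right fun p q r => by
    simp only [comp_comp, comp_dayMap, comp_dayAssoc_inv, comp_dayBraid, comp_id]
    rw [dayElt_eq_res R P (_ ≫ _), dayElt_res_left]
    simp only [Category.id_comp, whiskerLeft_id, Category.assoc, Symmetric.hexagon_reverse]

end Braiding

/-! ### The unit presheaf, the unitors and the symmetric monoidal structure -/

section Unit

variable (k : Type u) [Field k] (S : Type u) [Category.{u} S] [Preadditive S] [Linear k S]
  [SemigroupCategory S] [IsLinear k S]

variable {S} in
/-- The transformations of right module functors from `X ⊠ -` to the identity functor. -/
def unitSubmodule (X : S) : Submodule k (∀ Y : S, X ⊠ₛ Y ⟶ Y) where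
  carrier := {θ | (∀ {Y Z : S} (f : Y ⟶ Z), X ◁ₛ f ≫ θ Z = θ Y ≫ f) ∧
    ∀ Y K : S, (αₛ X Y K).hom ≫ θ (Y ⊠ₛ K) = θ Y ▷ₛ K}
  add_mem' {θ θ'} h h' :=
    ⟨fun f => by simp only [Pi.add_apply, Preadditive.comp_add, Preadditive.add_comp, h.1, h'.1],
      fun Y K => by
        simp only [Pi.add_apply, Preadditive.comp_add, h.2, h'.2, IsLinear.add_whiskerRight k]⟩
  zero_mem' :=
    ⟨fun f => by simp, fun Y K => by
      -- Compatibility with the scalar `0` gives `0 ▷ₛ K = 0`.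
      have h := IsLinear.smul_whiskerRight (0 : k) (0 : X ⊠ₛ Y ⟶ Y) K
      simpa using h.symm⟩
  smul_mem' r θ h :=
    ⟨fun f => by simp only [Pi.smul_apply, Linear.comp_smul, Linear.smul_comp, h.1],
      fun Y K => by simp only [Pi.smul_apply, Linear.comp_smul, h.2, IsLinear.smul_whiskerRight]⟩

/-- Restriction of module transformations along `f : X ⟶ Y`. -/
def unitRes {X Y : S} (f : X ⟶ Y) : unitSubmodule k Y →ₗ[k] unitSubmodule k X where
  toFun θ := ⟨fun Z => f ▷ₛ Z ≫ θ.1 Z,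
    fun g => by rw [← Category.assoc, whisker_exchange, Category.assoc, Category.assoc, θ.2.1],
    fun Z K => by
      rw [← Category.assoc, ← associator_naturality_left, Category.assoc, θ.2.2, comp_whiskerRight]⟩
  map_add' θ θ' := Subtype.ext (funext fun Z => Preadditive.comp_add _ _ _ _ _ _)
  map_smul' r θ := Subtype.ext (funext fun Z => Linear.comp_smul _ _ _ _ _ _)

/-- The unit object of Day convolution: `X` is sent to the space of transformations of right module
functors from `X ⊠ -` to the identity functor. -/
def dayUnit : LinPresheaf k S where
  obj :=
    { obj X := ModuleCat.of k (unitSubmodule k X.unop)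
      map f := ModuleCat.ofHom (unitRes k S f.unop)
      map_id X := by
        ext1
        refine LinearMap.ext fun θ => Subtype.ext (funext fun Z => ?_)
        exact (congrArg (· ≫ θ.1 Z) (id_whiskerRight _ _)).trans (Category.id_comp _)
      map_comp f g := by
        ext1
        refine LinearMap.ext fun θ => Subtype.ext (funext fun Z => ?_)
        exact (congrArg (· ≫ θ.1 Z) (comp_whiskerRight _ _ _)).trans (Category.assoc _ _ _) }
  property := by
    refine ⟨fun f g => ?_, fun r f => ?_⟩
    · ext1
      refine LinearMap.ext fun θ => Subtype.ext (funext fun Z => ?_)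
      exact (congrArg (· ≫ θ.1 Z) (IsLinear.add_whiskerRight k _ _ _)).trans
        (Preadditive.add_comp _ _ _ _ _ _)
    · ext1
      refine LinearMap.ext fun θ => Subtype.ext (funext fun Z => ?_)
      exact (congrArg (· ≫ θ.1 Z) (IsLinear.smul_whiskerRight _ _ _)).trans
        (Linear.smul_comp _ _ _ _ _ _)

variable {k S}

/-- The component `X ⊠ Y ⟶ Y` of an element of the unit presheaf. -/
def act {X : S} (θ : val (dayUnit k S) X) (Y : S) : X ⊠ₛ Y ⟶ Y :=
  Subtype.val (p := (· ∈ unitSubmodule k X)) θ Y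

theorem unit_ext {X : S} {θ θ' : val (dayUnit k S) X} (h : ∀ Y, act θ Y = act θ' Y) : θ = θ' :=
  Subtype.ext (p := (· ∈ unitSubmodule k X)) (funext h)

theorem act_add {X : S} (θ θ' : val (dayUnit k S) X) (Y : S) :
    act (θ + θ') Y = act θ Y + act θ' Y :=
  rfl

theorem act_smul {X : S} (r : k) (θ : val (dayUnit k S) X) (Y : S) :
    act (r • θ) Y = r • act θ Y :=
  rfl

theorem act_res {X X' : S} (f : X ⟶ X') (θ : val (dayUnit k S) X') (Y : S) :
    act (res (dayUnit k S) f θ) Y = f ▷ₛ Y ≫ act θ Y :=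
  rfl

theorem act_naturality {X : S} (θ : val (dayUnit k S) X) {Y Z : S} (f : Y ⟶ Z) :
    X ◁ₛ f ≫ act θ Z = act θ Y ≫ f :=
  (Subtype.property (p := (· ∈ unitSubmodule k X)) θ).1 f

theorem act_module {X : S} (θ : val (dayUnit k S) X) (Y K : S) :
    (αₛ X Y K).hom ≫ act θ (Y ⊠ₛ K) = act θ Y ▷ₛ K :=
  (Subtype.property (p := (· ∈ unitSubmodule k X)) θ).2 Y K

variable (k S) in
/-- For each object `X` an element of the unit presheaf which acts on `X` as a retraction. -/
structure LocalUnits where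
  obj : S → S
  elt (X : S) : val (dayUnit k S) (obj X)
  coact (X : S) : X ⟶ obj X ⊠ₛ X
  coact_act (X : S) : coact X ≫ act (elt X) X = 𝟙 X

theorem LocalUnits.coact_act_assoc (U : LocalUnits k S) {X Y : S} (f : X ⟶ Y) :
    U.coact X ≫ act (U.elt X) X ≫ f = f := by
  rw [← Category.assoc, U.coact_act, Category.id_comp]

variable (k) in
/-- The element of the unit presheaf on `F ⊠ F'` which is given by the counit of an adjunction. -/
def counitElt {F F' : S} (a : Adj F F') : val (dayUnit k S) (F ⊠ₛ F') :=
  Subtype.mk (p := (· ∈ unitSubmodule k (F ⊠ₛ F'))) a.εr ⟨a.εr_naturality, a.εr_module⟩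

theorem act_counitElt {F F' : S} (a : Adj F F') (Y : S) : act (counitElt k a) Y = a.εr Y :=
  rfl

variable (k) in
/-- The local units given by a choice of right duals. -/
def RightDuals.localUnits (D : RightDuals S) : LocalUnits k S where
  obj X := X ⊠ₛ D.dual X
  elt X := counitElt k (D.adj X)
  coact X := (D.adj X).ηl X ≫ (αₛ X (D.dual X) X).inv
  coact_act X := by
    rw [act_counitElt, Category.assoc]
    exact (D.adj X).zigzag₁

/-- The natural family which defines the left unitor of Day convolution. -/
def leftUnitorFamily (P : LinPresheaf k S) : DayFamily (dayUnit k S) P P where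
  toFun {_ K} θ p := res P (act θ K) p
  add_left θ θ' p := by rw [act_add, res_add]
  smul_left r θ p := by rw [act_smul, res_smul]
  add_right θ p p' := map_add _ _ _
  smul_right r θ p := map_smul _ _ _
  res_left a θ p := by rw [act_res, res_comp]
  res_right b θ p := by rw [← res_comp, ← res_comp, act_naturality]

/-- The linear map `p ↦ coact ⊗ elt ⊗ p`, a component of the inverse of the left unitor. -/
def leftUnitorInv (U : LocalUnits k S) (P : LinPresheaf k S) (X : S) :
    val P X →ₗ[k] val (dayConv (dayUnit k S) P) X where
  toFun p := dayElt _ P (U.coact X) (U.elt X) p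
  map_add' _ _ := dayElt_add₃ _ _ _ _ _ _
  map_smul' _ _ := dayElt_smul₃ _ _ _ _ _ _

theorem comp_leftUnitorInv (U : LocalUnits k S) (P : LinPresheaf k S) (X : S) (p : val P X) :
    comp (leftUnitorFamily P).desc X (leftUnitorInv U P X p) = p := by
  refine ((leftUnitorFamily P).comp_desc _ _ _).trans ?_
  refine (res_comp P _ _ p).symm.trans ?_
  rw [U.coact_act, res_id]

variable [Symmetric S]

/-- An element acts from the left by definition; the symmetry turns this into an action on `A` from
the right, and the two agree in the middle of `A ⊠ₛ B ⊠ₛ K`. This is the analogue of condition (IV)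
for an arbitrary element, and it is the triangle axiom in disguise. -/
theorem assoc_whiskerLeft_act (A : S) {B : S} (θ : val (dayUnit k S) B) (K : S) :
    (αₛ A B K).hom ≫ A ◁ₛ act θ K = ((βₛ A B).hom ≫ act θ A) ▷ₛ K := by
  -- Move `A` past `B ⊠ₛ K`, let `θ` act on `K ⊠ₛ A` through the module property, and move `A` back.
  -- The hexagon then splits the first braiding, and its factor on `K` cancels.
  have h : A ◁ₛ act θ K = (βₛ A (B ⊠ₛ K)).hom ≫ (αₛ B K A).hom ≫ B ◁ₛ (βₛ K A).hom ≫
      act θ (A ⊠ₛ K) := by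
    rw [act_naturality, ← Category.assoc _ _ (βₛ K A).hom, act_module,
      ← Category.assoc, ← Symmetric.braiding_naturality_right,
      Category.assoc, Symmetric.symmetry, Category.comp_id]
  have h' := Symmetric.hexagon_forward A B K
  rw [h, ← Category.assoc (βₛ A (B ⊠ₛ K)).hom, ← Category.assoc, h']
  simp only [Category.assoc]
  rw [← Category.assoc (B ◁ₛ _), ← whiskerLeft_comp, Symmetric.symmetry, whiskerLeft_id,
    Category.id_comp, act_module, comp_whiskerRight]

/-- Elements of the unit presheaf commute: on `Y`, both sides are, up to the associator, the
composite `W ⊠ₛ (H ⊠ₛ Y) ⟶ Y`, read once as `θ` then `ε` and once as `ε` then `θ`. The two agree by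
naturality of `ε` along `act θ Y`. -/
theorem res_braiding_act {W H : S} (ε : val (dayUnit k S) W) (θ : val (dayUnit k S) H) :
    res (dayUnit k S) ((βₛ W H).hom ≫ act θ W) ε = res (dayUnit k S) (act ε H) θ := by
  refine unit_ext fun Y => ?_
  rw [act_res, act_res, ← assoc_whiskerLeft_act, ← act_module, Category.assoc, Category.assoc,
    act_naturality]

theorem leftUnitorInv_comp (U : LocalUnits k S) (P : LinPresheaf k S) (X : S)
    (z : val (dayConv (dayUnit k S) P) X) :
    leftUnitorInv U P X (comp (leftUnitorFamily P).desc X z) = z := by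
  induction z using day_induction with
  | @elt H K u θ p =>
    have h : U.obj X ◁ₛ (u ≫ act θ K) = U.obj X ◁ₛ u ≫
        (αₛ (U.obj X) H K).inv ≫ ((βₛ (U.obj X) H).hom ≫ act θ _) ▷ₛ K := by
      rw [← assoc_whiskerLeft_act, Iso.inv_hom_id_assoc, whiskerLeft_comp]
    rw [DayFamily.comp_desc]
    refine (congrArg (leftUnitorInv U P X) (res_comp P u (act θ K) p).symm).trans ?_
    refine (dayElt_res_right _ _ _ _ _ _).trans ?_
    -- Now `θ` sits in the morphism and the local unit in the first slot. Commutation exchanges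
    -- them, after which the local unit acts on `H ⊠ₛ K`, slides past `u` and cancels against
    -- `coact`.
    rw [h, ← Category.assoc, ← Category.assoc, ← dayElt_res_left, res_braiding_act,
      dayElt_res_left, ← act_module, Category.assoc, Category.assoc, Iso.inv_hom_id_assoc,
      act_naturality, LocalUnits.coact_act_assoc]
  | add y z hy hz => rw [map_add, map_add, hy, hz]

/-- The left unitor of Day convolution. -/
def dayLeftUnitor (U : LocalUnits k S) (P : LinPresheaf k S) : dayConv (dayUnit k S) P ≅ P where
  hom := (leftUnitorFamily P).desc
  inv := mkHom (leftUnitorInv U P) fun {X Y} f p => by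
    -- The maps `coact` are not assumed natural; naturality holds because these components invert
    -- those of a natural map.
    conv_lhs => rw [← comp_leftUnitorInv U P Y p, ← comp_res, leftUnitorInv_comp]
  hom_inv_id := presheaf_hom_ext fun X z => leftUnitorInv_comp U P X z
  inv_hom_id := presheaf_hom_ext fun X p => comp_leftUnitorInv U P X p

theorem comp_dayLeftUnitor (U : LocalUnits k S) (P : LinPresheaf k S) {X H K : S} (u : X ⟶ H ⊠ₛ K)
    (θ : val (dayUnit k S) H) (p : val P K) :
    comp (dayLeftUnitor U P).hom X (dayElt (dayUnit k S) P u θ p) = res P (u ≫ act θ K) p :=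
  ((leftUnitorFamily P).comp_desc u θ p).trans (res_comp P u (act θ K) p).symm

/-- The right unitor of Day convolution. -/
def dayRightUnitor (U : LocalUnits k S) (P : LinPresheaf k S) : dayConv P (dayUnit k S) ≅ P :=
  dayBraid P (dayUnit k S) ≪≫ dayLeftUnitor U P

theorem comp_dayRightUnitor (U : LocalUnits k S) (P : LinPresheaf k S) {X H K : S}
    (u : X ⟶ H ⊠ₛ K) (p : val P H) (θ : val (dayUnit k S) K) :
    comp (dayRightUnitor U P).hom X (dayElt P (dayUnit k S) u p θ) =
      res P (u ≫ (βₛ H K).hom ≫ act θ H) p := by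
  rw [dayRightUnitor, Iso.trans_hom, comp_comp, comp_dayBraid, comp_dayLeftUnitor, Category.assoc]

theorem dayLeftUnitor_naturality (U : LocalUnits k S) {P Q : LinPresheaf k S} (φ : P ⟶ Q) :
    dayMap (𝟙 (dayUnit k S)) φ ≫ (dayLeftUnitor U Q).hom = (dayLeftUnitor U P).hom ≫ φ :=
  day_hom_ext fun θ p => by
    simp only [comp_comp, comp_dayMap, comp_dayLeftUnitor, comp_id, comp_res]

theorem dayRightUnitor_naturality (U : LocalUnits k S) {P Q : LinPresheaf k S} (φ : P ⟶ Q) :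
    dayMap φ (𝟙 (dayUnit k S)) ≫ (dayRightUnitor U Q).hom = (dayRightUnitor U P).hom ≫ φ :=
  day_hom_ext fun p θ => by
    simp only [comp_comp, comp_dayMap, comp_dayRightUnitor, comp_id, comp_res]

/-- On universal tensors the middle element acts on the right factor or, after a braiding, on the
left one; `assoc_whiskerLeft_act` identifies the two. -/
theorem dayTriangle (U : LocalUnits k S) (P Q : LinPresheaf k S) :
    (dayAssoc P (dayUnit k S) Q).hom ≫ dayMap (𝟙 P) (dayLeftUnitor U Q).hom =
      dayMap (dayRightUnitor U P).hom (𝟙 Q) :=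
  day_hom_ext_left fun p θ q => by
    simp only [comp_comp, comp_dayMap, comp_dayAssoc, comp_id, comp_dayLeftUnitor,
      comp_dayRightUnitor, dayElt_res_left, dayElt_res_right]
    simp only [Category.id_comp, id_whiskerRight, assoc_whiskerLeft_act]

/-- The monoidal structure given by Day convolution on presheaves on a symmetric semigroup category
with local units. -/
@[reducible]
def dayMonoidal (U : LocalUnits k S) : MonoidalCategory (LinPresheaf k S) :=
  letI : MonoidalCategoryStruct (LinPresheaf k S) :=
    { tensorObj := dayConv
      whiskerLeft P _ _ ψ := dayMap (𝟙 P) ψ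
      whiskerRight φ Q := dayMap φ (𝟙 Q)
      tensorHom := dayMap
      tensorUnit := dayUnit k S
      associator := dayAssoc
      leftUnitor := dayLeftUnitor U
      rightUnitor := dayRightUnitor U }
  MonoidalCategory.ofTensorHom
    (id_tensorHom_id := dayMap_id)
    (id_tensorHom := fun _ _ _ _ => rfl)
    (tensorHom_id := fun _ _ => rfl)
    (tensorHom_comp_tensorHom := fun φ ψ φ' ψ' => dayMap_comp φ φ' ψ ψ')
    (associator_naturality := dayAssoc_naturality)
    (leftUnitor_naturality := dayLeftUnitor_naturality U)
    (rightUnitor_naturality := dayRightUnitor_naturality U)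
    (pentagon := dayPentagon)
    (triangle := dayTriangle U)

/-- The symmetry of the Day convolution monoidal structure. -/
@[reducible]
def daySymmetric (U : LocalUnits k S) :
    letI := dayMonoidal U
    SymmetricCategory (LinPresheaf k S) :=
  letI := dayMonoidal U
  { braiding := dayBraid
    braiding_naturality_right := fun P _ _ ψ => dayBraid_naturality (𝟙 P) ψ
    braiding_naturality_left := fun φ R => dayBraid_naturality φ (𝟙 R)
    hexagon_forward := dayHexagon_forward
    hexagon_reverse := dayHexagon_reverse
    symmetry := dayBraid_symmetry }

theorem dayMonoidalPreadditive (U : LocalUnits k S) :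
    letI := dayMonoidal U
    MonoidalPreadditive (LinPresheaf k S) :=
  letI := dayMonoidal U
  { whiskerLeft_zero := fun {P Q R} => by
      have h := dayMap_smul_right (𝟙 P) (0 : k) (0 : Q ⟶ R)
      rwa [zero_smul, zero_smul] at h
    zero_whiskerRight := fun {P Q R} => by
      have h := dayMap_smul_left (0 : k) (0 : Q ⟶ R) (𝟙 P)
      rwa [zero_smul, zero_smul] at h
    whiskerLeft_add := fun {P _ _} ψ ψ' => dayMap_add_right (𝟙 P) ψ ψ'
    add_whiskerRight := fun {P _ _} φ φ' => dayMap_add_left φ φ' (𝟙 P) }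

theorem dayMonoidalLinear (U : LocalUnits k S) :
    letI := dayMonoidal U
    haveI := dayMonoidalPreadditive U
    MonoidalLinear k (LinPresheaf k S) :=
  letI := dayMonoidal U
  haveI := dayMonoidalPreadditive U
  { whiskerLeft_smul := fun P _ _ r ψ => dayMap_smul_right (𝟙 P) r ψ
    smul_whiskerRight := fun r _ _ φ P => dayMap_smul_left r φ (𝟙 P) }

/-- The Day convolution monoidal structure is one whose tensor product is Day convolution. -/
def dayStructure (U : LocalUnits k S) :
    letI := dayMonoidal U
    letI := daySymmetric U
    DayStructure k S :=
  letI := dayMonoidal U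
  letI := daySymmetric U
  { iso := fun P Q => Iso.refl (dayConv P Q)
    iso_naturality := fun φ ψ => (Category.comp_id _).trans (Category.id_comp (dayMap φ ψ)).symm
    associator_hom := fun P Q R _ _ _ _ _ u v p q r => comp_dayAssoc P Q R u v p q r
    braiding_hom := fun P Q _ _ _ u p q => comp_dayBraid P Q u p q }

end Unit

/-! ### Cyclic permutations and the contraction of internal homs -/

section Coherence

variable {S : Type u} [Category.{v} S] [SemigroupCategory S]

@[simp]
theorem whiskerLeft_hom_inv (W : S) {X Y : S} (e : X ≅ Y) : W ◁ₛ e.hom ≫ W ◁ₛ e.inv = 𝟙 _ := by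
  rw [← whiskerLeft_comp, e.hom_inv_id, whiskerLeft_id]

@[simp]
theorem whiskerLeft_inv_hom (W : S) {X Y : S} (e : X ≅ Y) : W ◁ₛ e.inv ≫ W ◁ₛ e.hom = 𝟙 _ := by
  rw [← whiskerLeft_comp, e.inv_hom_id, whiskerLeft_id]

/-- The left whiskering of an isomorphism. -/
@[simps]
def whiskerLeftIso (W : S) {X Y : S} (e : X ≅ Y) : W ⊠ₛ X ≅ W ⊠ₛ Y where
  hom := W ◁ₛ e.hom
  inv := W ◁ₛ e.inv

theorem IsRigid.nonempty_rightDuals (hS : IsRigid S) : Nonempty (RightDuals S) :=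
  ⟨fun F => (hS F).1.choose, fun F => (hS F).1.choose_spec.some⟩

variable [Symmetric S]

/-- Both composites carry `C` to the front: one by moving `A` and then `B` to the back, the other in
a single step. Each hexagon splits a braiding into elementary ones, and the two swaps of `A` and `B`
cancel. -/
theorem braiding_rotate (A B C : S) :
    (βₛ A (B ⊠ₛ C)).hom ≫ (αₛ B C A).hom ≫ (βₛ B (C ⊠ₛ A)).hom =
      (αₛ A B C).inv ≫ (βₛ (A ⊠ₛ B) C).hom ≫ (αₛ C A B).inv := by
  have h₁ := Symmetric.hexagon_forward B C A
  have h₂ := Symmetric.hexagon_forward A C B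
  rw [Symmetric.hexagon_reverse, ← cancel_mono (αₛ C A B).hom]
  simp only [Category.assoc]
  rw [h₁, ← Category.assoc, ← Symmetric.braiding_naturality_right, Category.assoc]
  have h₃ : (βₛ A (C ⊠ₛ B)).hom ≫ (αₛ C B A).hom =
      (αₛ A C B).inv ≫ (βₛ A C).hom ▷ₛ B ≫ (αₛ C A B).hom ≫ C ◁ₛ (βₛ A B).hom := by
    rw [← h₂, Iso.inv_hom_id_assoc]
  rw [← Category.assoc (βₛ A (C ⊠ₛ B)).hom, h₃]
  simp only [Category.assoc]
  rw [← whiskerLeft_comp, Symmetric.symmetry, whiskerLeft_id, Category.comp_id]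

/-- The cyclic permutation `(A ⊠ B) ⊠ (C ⊠ D) ≅ (B ⊠ C) ⊠ (D ⊠ A)`. -/
def cyclicIso (A B C D : S) : (A ⊠ₛ B) ⊠ₛ (C ⊠ₛ D) ≅ (B ⊠ₛ C) ⊠ₛ (D ⊠ₛ A) :=
  αₛ A B (C ⊠ₛ D) ≪≫ whiskerLeftIso A (αₛ B C D).symm ≪≫ βₛ A ((B ⊠ₛ C) ⊠ₛ D) ≪≫
    αₛ (B ⊠ₛ C) D A

theorem cyclicIso_hom (A B C D : S) :
    (cyclicIso A B C D).hom = (αₛ A B (C ⊠ₛ D)).hom ≫ A ◁ₛ (αₛ B C D).inv ≫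
      (βₛ A ((B ⊠ₛ C) ⊠ₛ D)).hom ≫ (αₛ (B ⊠ₛ C) D A).hom :=
  rfl

/-- Both sides realize the same permutation of four factors. Two uses of `braiding_rotate`, with the
pentagon for rebracketing, bring them to a common form. -/
theorem braiding_cyclicIso (A B C D : S) :
    (βₛ (A ⊠ₛ B) (C ⊠ₛ D)).hom ≫ (cyclicIso C D A B).hom =
      (cyclicIso A B C D).hom ≫ (βₛ (B ⊠ₛ C) (D ⊠ₛ A)).hom := by
  have p₁ : (αₛ D (A ⊠ₛ B) C).inv ≫ (αₛ D A B).inv ▷ₛ C ≫ (αₛ (D ⊠ₛ A) B C).hom =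
      D ◁ₛ (αₛ A B C).hom ≫ (αₛ D A (B ⊠ₛ C)).inv := by
    have h := pentagon D A B C
    rw [Iso.inv_comp_eq, ← Category.assoc, Iso.eq_comp_inv, Category.assoc, ← h,
      ← Category.assoc, ← comp_whiskerRight, Iso.inv_hom_id, id_whiskerRight, Category.id_comp]
  have p₂ : (αₛ (A ⊠ₛ B) C D).inv ≫ (αₛ A B C).hom ▷ₛ D =
      (αₛ A B (C ⊠ₛ D)).hom ≫ A ◁ₛ (αₛ B C D).inv ≫ (αₛ A (B ⊠ₛ C) D).inv := by
    have h := pentagon A B C D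
    rw [Iso.inv_comp_eq, ← Category.assoc, ← h]
    simp only [Category.assoc]
    rw [← Category.assoc (A ◁ₛ _), ← whiskerLeft_comp, Iso.hom_inv_id, whiskerLeft_id,
      Category.id_comp, Iso.hom_inv_id, Category.comp_id]
  have n₁ : C ◁ₛ (αₛ D A B).inv ≫ (βₛ C ((D ⊠ₛ A) ⊠ₛ B)).hom =
      (βₛ C (D ⊠ₛ (A ⊠ₛ B))).hom ≫ (αₛ D A B).inv ▷ₛ C :=
    Symmetric.braiding_naturality_right _ _
  have n₂ : (βₛ ((A ⊠ₛ B) ⊠ₛ C) D).hom ≫ D ◁ₛ (αₛ A B C).hom =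
      (αₛ A B C).hom ▷ₛ D ≫ (βₛ (A ⊠ₛ (B ⊠ₛ C)) D).hom :=
    (Symmetric.braiding_naturality_left _ _).symm
  have r₁ := braiding_rotate (A ⊠ₛ B) C D
  have r₂ := braiding_rotate A (B ⊠ₛ C) D
  calc
    _ = ((βₛ (A ⊠ₛ B) (C ⊠ₛ D)).hom ≫ (αₛ C D (A ⊠ₛ B)).hom ≫ (βₛ C (D ⊠ₛ (A ⊠ₛ B))).hom) ≫
          (αₛ D A B).inv ▷ₛ C ≫ (αₛ (D ⊠ₛ A) B C).hom := by
      rw [cyclicIso_hom, ← Category.assoc (C ◁ₛ _), n₁]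
      simp only [Category.assoc]
    _ = (αₛ (A ⊠ₛ B) C D).inv ≫ ((βₛ ((A ⊠ₛ B) ⊠ₛ C) D).hom ≫ D ◁ₛ (αₛ A B C).hom) ≫
          (αₛ D A (B ⊠ₛ C)).inv := by
      rw [r₁]
      simp only [Category.assoc]
      rw [p₁]
    _ = ((αₛ (A ⊠ₛ B) C D).inv ≫ (αₛ A B C).hom ▷ₛ D) ≫ (βₛ (A ⊠ₛ (B ⊠ₛ C)) D).hom ≫
          (αₛ D A (B ⊠ₛ C)).inv := by
      rw [n₂]
      simp only [Category.assoc]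
    _ = _ := by
      rw [p₂, cyclicIso_hom]
      simp only [Category.assoc]
      rw [r₂]

/-- Naturality of the braiding moves `F'` behind the contracted pair `G ⊠ₛ G'`; the module property
of `ε^r` then absorbs it into the argument of the counit. -/
theorem contract_braiding (D : RightDuals S) (F G H : S) :
    D.contract F G H ≫ (βₛ (D.dual F) H).hom =
      (cyclicIso (D.dual F) G (D.dual G) H).hom ≫ (D.adj G).εr (H ⊠ₛ D.dual F) := by
  have h : ((αₛ (D.dual F) G (D.dual G ⊠ₛ H)).hom ≫ D.dual F ◁ₛ (αₛ G (D.dual G) H).inv ≫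
      D.dual F ◁ₛ (D.adj G).εr H) ≫ (βₛ (D.dual F) H).hom =
      (cyclicIso (D.dual F) G (D.dual G) H).hom ≫ (D.adj G).εr (H ⊠ₛ D.dual F) := by
    rw [cyclicIso_hom]
    simp only [Category.assoc]
    rw [Symmetric.braiding_naturality_right, (D.adj G).εr_module]
  exact h

end Coherence

/-! ### The unit presheaf by generators and relations -/

section UniversalProperty

variable {k : Type u} [Field k] {S : Type u} [Category.{u} S] [Preadditive S] [Linear k S]
  [SemigroupCategory S] [IsLinear k S] [Symmetric S] (U : LocalUnits k S) {T : LinPresheaf k S}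

namespace LocalUnits

/-- A morphism `s(θ)` along which the local unit `elt X` restricts to `θ`. -/
def lift {X : S} (θ : val (dayUnit k S) X) : X ⟶ U.obj X :=
  U.coact X ≫ (βₛ (U.obj X) X).hom ≫ act θ (U.obj X)

/-- Commutation of `θ` with the local unit at `X` turns the restriction into one of `θ` along
`coact` followed by the action of that unit, which is the identity. So the local units generate. -/
theorem res_lift {X : S} (θ : val (dayUnit k S) X) :
    res (dayUnit k S) (U.lift θ) (U.elt X) = θ := by
  rw [lift, res_comp, res_braiding_act, ← res_comp, U.coact_act, res_id]

/-- The compatibility of a family of elements of `T` in the degrees of the local units which says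
that the family is the image of the local units under a morphism from the unit presheaf. -/
def Compatible (t : ∀ X, val T (U.obj X)) : Prop :=
  ∀ F G : S, res T ((βₛ (U.obj G) (U.obj F)).hom ≫ act (U.elt F) (U.obj G)) (t G) =
    res T (act (U.elt G) (U.obj F)) (t F)

variable {U} {t : ∀ X, val T (U.obj X)}

/-- The restriction of `t H` along `w` depends on `w` only through the restricted local unit, so the
pairwise relations imply all others. This makes `Compatible.desc` natural, and the case `w = 𝟙`
computes it on generators. -/
theorem Compatible.res_eq (ht : U.Compatible t) {X H : S} (w : X ⟶ U.obj H) :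
    res T w (t H) = res T (U.lift (res (dayUnit k S) w (U.elt H))) (t X) := by
  -- Inserting the local unit at `X` makes its action on `U.obj H` appear, which is where
  -- compatibility of the pair `H`, `X` applies.
  have h : w = U.coact X ≫ U.obj X ◁ₛ w ≫ act (U.elt X) (U.obj H) := by
    rw [act_naturality, U.coact_act_assoc]
  conv_lhs => rw [h, res_comp, res_comp, ← ht H X, ← res_comp, ← res_comp]
  rw [lift, act_res, Category.assoc, ← Category.assoc (U.obj X ◁ₛ w),
    Symmetric.braiding_naturality_right, Category.assoc]

/-- The morphism from the unit presheaf which is given by a compatible family. -/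
def Compatible.desc (ht : U.Compatible t) : dayUnit k S ⟶ T :=
  mkHom
    (fun X =>
      { toFun := fun θ => res T (U.lift θ) (t X)
        map_add' := fun θ θ' => by
          rw [← res_add, lift, act_add, Preadditive.comp_add, Preadditive.comp_add]
          rfl
        map_smul' := fun r θ => by
          rw [RingHom.id_apply, ← res_smul, lift, act_smul, Linear.comp_smul, Linear.comp_smul]
          rfl })
    fun {X Y} f θ => by
      -- Along this morphism the local unit at `Y` restricts to `res f θ`, by `res_lift`.
      have h := ht.res_eq (f ≫ U.lift θ)
      rw [res_comp, res_comp, res_lift] at h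
      exact h.symm

theorem Compatible.comp_desc (ht : U.Compatible t) {X : S} (θ : val (dayUnit k S) X) :
    comp ht.desc X θ = res T (U.lift θ) (t X) :=
  rfl

theorem Compatible.comp_desc_elt (ht : U.Compatible t) (H : S) :
    comp ht.desc (U.obj H) (U.elt H) = t H := by
  have h := ht.res_eq (𝟙 (U.obj H))
  rw [res_id, res_id] at h
  exact h.symm

variable (U) in
theorem hom_ext {φ ψ : dayUnit k S ⟶ T}
    (h : ∀ H, comp φ (U.obj H) (U.elt H) = comp ψ (U.obj H) (U.elt H)) : φ = ψ :=
  presheaf_hom_ext fun X θ => by rw [← U.res_lift θ, comp_res, comp_res, h]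

end LocalUnits

end UniversalProperty

/-! ### Yoneda and the identification of the unit with the enriched trace -/

section Trace

open Limits

variable {k : Type u} [Field k] {S : Type u} [Category.{u} S] [Preadditive S] [Linear k S]

/-- The morphism from a representable presheaf which is given by an element. -/
def yoDesc {T : LinPresheaf k S} {F : S} (t : val T F) : yo k F ⟶ T :=
  mkHom
    (fun X =>
      { toFun := fun f : X ⟶ F => res T f t
        map_add' := fun f g => res_add T f g t
        map_smul' := fun r f => res_smul T r f t })
    fun g f => res_comp T g f t

/-- The element which corresponds to a morphism from a representable presheaf. -/
def yoElt {T : LinPresheaf k S} {F : S} (φ : yo k F ⟶ T) : val T F :=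
  comp φ F (𝟙 F : F ⟶ F)

theorem yoElt_yoDesc {T : LinPresheaf k S} {F : S} (t : val T F) : yoElt (yoDesc t) = t :=
  res_id T t

theorem yoElt_comp {T T' : LinPresheaf k S} {F : S} (φ : yo k F ⟶ T) (ψ : T ⟶ T') :
    yoElt (φ ≫ ψ) = comp ψ F (yoElt φ) :=
  rfl

theorem comp_eq_res_yoElt {T : LinPresheaf k S} {F X : S} (φ : yo k F ⟶ T) (f : X ⟶ F) :
    comp φ X f = res T f (yoElt φ) := by
  refine Eq.trans ?_ (comp_res φ f (𝟙 F : F ⟶ F))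
  exact congrArg (comp φ X) (Category.comp_id f).symm

theorem yoElt_injective {T : LinPresheaf k S} {F : S} {φ ψ : yo k F ⟶ T}
    (h : yoElt φ = yoElt ψ) : φ = ψ :=
  presheaf_hom_ext fun _ f =>
    (comp_eq_res_yoElt φ f).trans ((congrArg _ h).trans (comp_eq_res_yoElt ψ f).symm)

theorem yoElt_yoMap_comp {T : LinPresheaf k S} {F G : S} (f : F ⟶ G) (φ : yo k G ⟶ T) :
    yoElt (yoMap k f ≫ φ) = res T f (yoElt φ) := by
  refine Eq.trans ?_ (comp_eq_res_yoElt φ f)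
  exact congrArg (comp φ F) (Category.id_comp f)

variable [SemigroupCategory S] [IsLinear k S] [Symmetric S]

namespace RightDuals

variable (k) (D : RightDuals S)

/-- The symmetry `[F, F] = F' ⊠ F ≅ F ⊠ F'`. -/
def ihomIso (F : S) : D.ihom F F ≅ (D.localUnits k).obj F :=
  βₛ (D.dual F) F

/-- The cyclic permutation `[F, G] ⊠ [G, F] = (F' ⊠ G) ⊠ (G' ⊠ F) ≅ (G ⊠ G') ⊠ (F ⊠ F')`. -/
def ihomCyclicIso (F G : S) :
    D.ihom F G ⊠ₛ D.ihom G F ≅ (D.localUnits k).obj G ⊠ₛ (D.localUnits k).obj F :=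
  cyclicIso (D.dual F) G (D.dual G) F

/-- The symmetry cancels the one built into `icomp` and leaves the bare contraction of `G ⊠ₛ G'`. -/
theorem braiding_icomp_ihomIso (F G : S) :
    ((βₛ (D.ihom F G) (D.ihom G F)).hom ≫ D.icomp F G F) ≫ (D.ihomIso k F).hom =
      (D.ihomCyclicIso k F G).hom ≫ act ((D.localUnits k).elt G) ((D.localUnits k).obj F) := by
  rw [icomp, symmetry_assoc]
  exact contract_braiding D F G F

/-- Here the symmetry inside `icomp` remains; `braiding_cyclicIso` moves it behind the cyclic
permutation. Both maps of the trace diagram thus factor through one isomorphism, followed by the two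
sides of the commutation relation. -/
theorem icomp_ihomIso (F G : S) :
    D.icomp G F G ≫ (D.ihomIso k G).hom =
      (D.ihomCyclicIso k F G).hom ≫
        (βₛ ((D.localUnits k).obj G) ((D.localUnits k).obj F)).hom ≫
          act ((D.localUnits k).elt F) ((D.localUnits k).obj G) := by
  rw [icomp, Category.assoc]
  refine (congrArg (_ ≫ ·) (contract_braiding D G F G)).trans ?_
  refine (Category.assoc _ _ _).symm.trans ?_
  refine (congrArg (· ≫ _) (braiding_cyclicIso (D.dual F) G (D.dual G) F)).trans ?_
  exact Category.assoc _ _ _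

theorem compatible_iff {T : LinPresheaf k S} (t : ∀ H, val T ((D.localUnits k).obj H)) :
    (D.localUnits k).Compatible t ↔ ∀ F G : S,
      res T (D.icomp G F G) (res T (D.ihomIso k G).hom (t G)) =
        res T ((βₛ (D.ihom F G) (D.ihom G F)).hom ≫ D.icomp F G F)
          (res T (D.ihomIso k F).hom (t F)) := by
  refine forall_congr' fun F => forall_congr' fun G => ?_
  rw [← res_comp, ← res_comp, icomp_ihomIso, braiding_icomp_ihomIso,
    res_comp T (D.ihomCyclicIso k F G).hom, res_comp T (D.ihomCyclicIso k F G).hom]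
  -- Restriction along the cyclic isomorphism is injective, so it can be cancelled.
  refine ⟨congrArg _, fun h => ?_⟩
  have h' := congrArg (res T (D.ihomCyclicIso k F G).inv) h
  rwa [← res_comp T _ (D.ihomCyclicIso k F G).hom, ← res_comp T _ (D.ihomCyclicIso k F G).hom,
    Iso.inv_hom_id, res_id, res_id] at h'

theorem compatible_elt : (D.localUnits k).Compatible (D.localUnits k).elt :=
  fun _ _ => res_braiding_act _ _

theorem comp_elt_eq {T : LinPresheaf k S} (φ : dayUnit k S ⟶ T) (H : S) :
    comp φ ((D.localUnits k).obj H) ((D.localUnits k).elt H) =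
      res T (D.ihomIso k H).inv
        (yoElt (yoDesc (res (dayUnit k S) (D.ihomIso k H).hom ((D.localUnits k).elt H)) ≫ φ)) := by
  rw [yoElt_comp, yoElt_yoDesc, ← comp_res, ← res_comp, Iso.inv_hom_id, res_id]

/-- The cofork which exhibits the unit presheaf as the enriched trace. -/
def traceCofork : Multicofork (traceDiagram k D) :=
  Multicofork.ofπ (traceDiagram k D) (dayUnit k S)
    (fun H => yoDesc (res (dayUnit k S) (D.ihomIso k H).hom ((D.localUnits k).elt H)))
    fun i => yoElt_injective <| by
      refine (yoElt_yoMap_comp _ _).trans (Eq.trans ?_ (yoElt_yoMap_comp _ _).symm)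
      rw [yoElt_yoDesc, yoElt_yoDesc]
      exact (D.compatible_iff k _).1 (D.compatible_elt k) i.1 i.2

variable {k D} in
/-- The elements in the degrees `H ⊠ H'` which correspond to the legs of a cofork. -/
def coforkElt (E : Multicofork (traceDiagram k D)) (H : S) : val E.pt ((D.localUnits k).obj H) :=
  res E.pt (D.ihomIso k H).inv (yoElt (E.π H))

variable {k D} in
theorem res_coforkElt (E : Multicofork (traceDiagram k D)) (H : S) :
    res E.pt (D.ihomIso k H).hom (coforkElt E H) = yoElt (E.π H) := by
  rw [coforkElt, ← res_comp, Iso.hom_inv_id, res_id]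

variable {k D} in
theorem compatible_coforkElt (E : Multicofork (traceDiagram k D)) :
    (D.localUnits k).Compatible (coforkElt E) := by
  refine (D.compatible_iff k _).2 fun F G => ?_
  rw [res_coforkElt, res_coforkElt]
  have h := congrArg yoElt (E.condition (F, G))
  exact (yoElt_yoMap_comp _ _).symm.trans (h.trans (yoElt_yoMap_comp _ _))

/-- The unit presheaf is the enriched trace. -/
def isColimitTraceCofork : IsColimit (D.traceCofork k) :=
  Multicofork.IsColimit.mk _ (fun E => (compatible_coforkElt E).desc)
    (fun E H => yoElt_injective <| by
      refine (yoElt_comp (yoDesc _) (compatible_coforkElt E).desc).trans ?_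
      rw [yoElt_yoDesc, comp_res, LocalUnits.Compatible.comp_desc_elt, res_coforkElt])
    (fun E m hm => LocalUnits.hom_ext (D.localUnits k) fun H => by
      rw [LocalUnits.Compatible.comp_desc_elt, coforkElt, ← hm H]
      exact D.comp_elt_eq k m H)

theorem isEnrichedTrace_dayUnit : IsEnrichedTrace k D (dayUnit k S) :=
  ⟨D.traceCofork k, ⟨D.isColimitTraceCofork k⟩, ⟨Iso.refl _⟩⟩

end RightDuals

end Trace

end

end SemigroupCategory

theorem mainTheorem11 (k : Type u) [Field k] (S : Type u) [Category.{u} S] [Preadditive S]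
    [Linear k S] [SemigroupCategory S] [SemigroupCategory.IsLinear k S]
    [SemigroupCategory.Symmetric S] (hS : SemigroupCategory.IsRigid S) :
    ∃ (_ : MonoidalCategory (SemigroupCategory.LinPresheaf k S))
      (_ : SymmetricCategory (SemigroupCategory.LinPresheaf k S))
      (_ : MonoidalPreadditive (SemigroupCategory.LinPresheaf k S)),
      MonoidalLinear k (SemigroupCategory.LinPresheaf k S) ∧
      Nonempty (SemigroupCategory.DayStructure k S) ∧
      ∀ D : SemigroupCategory.RightDuals S, SemigroupCategory.IsEnrichedTrace k D
        (MonoidalCategoryStruct.tensorUnit (SemigroupCategory.LinPresheaf k S)) := by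
  obtain ⟨D⟩ := hS.nonempty_rightDuals
  exact ⟨SemigroupCategory.dayMonoidal (D.localUnits k),
    SemigroupCategory.daySymmetric (D.localUnits k),
    SemigroupCategory.dayMonoidalPreadditive (D.localUnits k),
    SemigroupCategory.dayMonoidalLinear (D.localUnits k),
    ⟨SemigroupCategory.dayStructure (D.localUnits k)⟩,
    -- The unit presheaf does not involve the duals used for the unitors, so every other choice `D'`
    -- presents the same object as its trace.
    fun D' => D'.isEnrichedTrace_dayUnit k⟩
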